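/- Let $n\ge 2$. For $\lambda\neq0$ let $\eta_\lambda$ be the nondegenerate symmetric bilinear form on $\mathbb R^{n+1}=\mathbb R\times\mathbb R^n$ with matrix $\mathrm{diag}\big(\tfrac1{\sqrt\lambda},\sqrt\lambda\, I_n\big)$ if $\lambda>0$ and $\mathrm{diag}\big(\tfrac{-1}{\sqrt{-\lambda}},\sqrt{-\lambda}\, I_n\big)$ if $\lambda<0$, and let $\mathsf{SO}(\eta_\lambda)\subset\mathsf{GL}(n+1)$ be the group of linear isomorphisms of determinant $1$ that preserve $\eta_\lambda$. Define subgroups $G_\lambda\subset\mathsf{GL}(n+1)$ by: $G_\lambda=\mathsf{SO}(\eta_\lambda)$ if $\lambda>0$; $G_0=\left\{\begin{pmatrix}1&0\\ w&B\end{pmatrix}: w\in\mathbb R^n,\ B\in\mathsf{SO}(n)\right\}$; and $G_\lambda$ is the identity component of $\mathsf{SO}(\eta_\lambda)$ if $\lambda<0$. Let $M_\lambda=\{(x_0,x')\in\mathbb R\times\mathbb R^n: x_0^2+\lambda\|x'\|^2=1,\ \text{and } x_0>0 \text{ if } \lambda\le0\}$, with the metric induced by $\lambda^{-1}dx_0^2+\|dx'\|^2$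 if $\lambda\ne0$ and by $\|dx'\|^2$ if $\lambda=0$; this is the simply connected $n$-dimensional space form of curvature $\lambda$ (up to rescaling $x_0$: the sphere of radius $1/\sqrt\lambda$, Euclidean space, respectively a sheet of the hyperboloid of radius $1/\sqrt{-\lambda}$). Then: (1) For every $\lambda\in\mathbb R$, the group $G_\lambda$ preserves $M_\lambda$ and acts on it by isometries, and this action is an isomorphism of topological groups from $G_\lambda$ onto the identity component of the isometry group of $M_\lambda$. (2) The set $\mathcal G=\bigcup_{\lambda\in\mathbb R}\{\lambda\}\times G_\lambda$ is a smooth embedded submanifold of $\mathbb R\times\mathsf{GL}(n+1)$ of dimension $1+\tfrac12n(n+1)$ and, with the projection $\mathfrak s\colon\mathcal G\to\mathbb R$ and fibrewise matrix multiplication, it is a smooth bundle of Lie groups over $\mathbb R$, i.e. a Lie groupoid whose source and target maps are both equal to $\mathfrak s$ (so $\mathfrak s$ is a submersion, and composition, inversion and the unit section are smooth). (3) This bundle is not locally trivial at $0$, not even topologically: there are no open neighbourhood $U$ of $0$ in $\mathbb R$ and homeomorphism $\mathfrak s^{-1}(U)\to U\times G_0$ commuting with the projections to $U$. -/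

import Mathlib

open scoped Manifold ContDiff
open Manifold

noncomputable section

/-- A (smooth) Lie groupoid with space of arrows `𝒢` over the connected smooth manifold `Λ`: the
source and target maps are smooth submersions, the (partial) composition, the inversion and the
unit section are smooth, and the groupoid axioms hold. The composition `g · h` is defined exactly
when `source g = target h`. The fibre product `{(g, h) | source g = target h}` is an embedded
submanifold of `𝒢 × 𝒢`, and smoothness on it is expressed by `ContMDiffOn`; the value given to the
composition outside of the fibre product is irrelevant. -/
structure LieGroupoid {EΛ HΛ E H : Type*}
    [NormedAddCommGroup EΛ] [NormedSpace ℝ EΛ] [TopologicalSpace HΛ]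
    (I : ModelWithCorners ℝ EΛ HΛ)
    [NormedAddCommGroup E] [NormedSpace ℝ E] [TopologicalSpace H]
    (J : ModelWithCorners ℝ E H)
    (Λ : Type*) [TopologicalSpace Λ] [ConnectedSpace Λ] [ChartedSpace HΛ Λ] [IsManifold I ∞ Λ]
    (𝒢 : Type*) [TopologicalSpace 𝒢] [ChartedSpace H 𝒢] [IsManifold J ∞ 𝒢] where
  /-- The source map. -/
  source : 𝒢 → Λ
  /-- The target map. -/
  target : 𝒢 → Λ
  /-- The composition of composable arrows. -/
  comp : (g h : 𝒢) → source g = target h → 𝒢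
  /-- The inversion. -/
  inv : 𝒢 → 𝒢
  /-- The unit section. -/
  unit : Λ → 𝒢
  source_comp : ∀ g h e, source (comp g h e) = source h
  target_comp : ∀ g h e, target (comp g h e) = target g
  comp_assoc : ∀ (g h k : 𝒢) (e : source g = target h) (e' : source h = target k),
    comp (comp g h e) k ((source_comp g h e).trans e') =
      comp g (comp h k e') (e.trans (target_comp h k e').symm)
  source_unit : ∀ l, source (unit l) = l
  target_unit : ∀ l, target (unit l) = l
  unit_comp : ∀ g, comp (unit (target g)) g (source_unit _) = g
  comp_unit : ∀ g, comp g (unit (source g)) (target_unit _).symm = g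
  source_inv : ∀ g, source (inv g) = target g
  target_inv : ∀ g, target (inv g) = source g
  inv_comp : ∀ g, comp (inv g) g (source_inv g) = unit (source g)
  comp_inv : ∀ g, comp g (inv g) (target_inv g).symm = unit (target g)
  isSubmersion_source : IsSubmersion J I ∞ source
  isSubmersion_target : IsSubmersion J I ∞ target
  contMDiffOn_comp : ContMDiffOn (J.prod J) J ∞
    (fun p : 𝒢 × 𝒢 ↦ open Classical in
      if e : source p.1 = target p.2 then comp p.1 p.2 e else p.1)
    {p | source p.1 = target p.2}
  contMDiff_inv : ContMDiff J J ∞ inv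
  contMDiff_unit : ContMDiff I J ∞ unit

namespace LieGroupoid

variable {EΛ HΛ E H : Type*}
    [NormedAddCommGroup EΛ] [NormedSpace ℝ EΛ] [TopologicalSpace HΛ]
    {I : ModelWithCorners ℝ EΛ HΛ}
    [NormedAddCommGroup E] [NormedSpace ℝ E] [TopologicalSpace H]
    {J : ModelWithCorners ℝ E H}
    {Λ : Type*} [TopologicalSpace Λ] [ConnectedSpace Λ] [ChartedSpace HΛ Λ] [IsManifold I ∞ Λ]
    {𝒢 : Type*} [TopologicalSpace 𝒢] [ChartedSpace H 𝒢] [IsManifold J ∞ 𝒢]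

/-- A bundle of Lie groups over `Λ` is a Lie groupoid over `Λ` whose source and target maps
coincide. -/
def IsLieGroupBundle (B : LieGroupoid I J Λ 𝒢) : Prop :=
  B.source = B.target

/-- Topological local triviality of the source map at `l₀`: for some open neighbourhood `U` of
`l₀`, there is a homeomorphism over `U` between `source ⁻¹ U` and `U × source ⁻¹ l₀`. This is
implied by every notion of local triviality which in addition asks the trivialization to be
a diffeomorphism or to be compatible with the groupoid operations. -/
def IsTopologicallyLocallyTrivialAt (B : LieGroupoid I J Λ 𝒢) (l₀ : Λ) : Prop :=
  ∃ U : Set Λ, IsOpen U ∧ l₀ ∈ U ∧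
    ∃ Φ : (B.source ⁻¹' U) ≃ₜ U × (B.source ⁻¹' {l₀}),
      ∀ g, ((Φ g).1 : Λ) = B.source g

end LieGroupoid

namespace SpaceForms

/-- The Euclidean space `ℝ^(n+1)`, with coordinates `x 0` and `x i.succ` for `i : Fin n`. -/
abbrev V (n : ℕ) : Type := EuclideanSpace ℝ (Fin (n + 1))

/-- The Lie group `GL(n+1)` of invertible linear endomorphisms of `ℝ^(n+1)`. -/
abbrev GLV (n : ℕ) : Type := (V n →L[ℝ] V n)ˣ

/-- For `l ≠ 0`, the nondegenerate symmetric bilinear form with matrix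
`diag(1/√l, √l, …, √l)` for `0 < l`, and `diag(-1/√(-l), √(-l), …, √(-l))` for `l < 0`. -/
def eta (n : ℕ) (l : ℝ) (x y : V n) : ℝ :=
  if 0 < l then
    1 / √l * (x 0 * y 0) + √l * ∑ i : Fin n, x i.succ * y i.succ
  else
    -1 / √(-l) * (x 0 * y 0) + √(-l) * ∑ i : Fin n, x i.succ * y i.succ

/-- The group `SO(η)` of linear isomorphisms with determinant `1` preserving the form `η_l`. -/
def SOeta (n : ℕ) (l : ℝ) : Subgroup (GLV n) where
  carrier := {g | (∀ x y, eta n l ((g : V n →L[ℝ] V n) x) ((g : V n →L[ℝ] V n) y) = eta n l x y) ∧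
    LinearMap.det ((g : V n →L[ℝ] V n) : V n →ₗ[ℝ] V n) = 1}
  one_mem' := ⟨fun _ _ ↦ rfl, LinearMap.det_id⟩
  mul_mem' := by
    rintro g h ⟨hg, hg'⟩ ⟨hh, hh'⟩
    refine ⟨fun x y ↦ (hg _ _).trans (hh x y), ?_⟩
    have := LinearMap.det_comp ((g : V n →L[ℝ] V n) : V n →ₗ[ℝ] V n)
      ((h : V n →L[ℝ] V n) : V n →ₗ[ℝ] V n)
    rw [hg', hh', one_mul] at this
    exact this
  inv_mem' := by
    rintro g ⟨hg, hg'⟩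
    have key : ∀ x, (g : V n →L[ℝ] V n) ((g⁻¹ : GLV n).val x) = x := fun x ↦
      congrArg (fun f : V n →L[ℝ] V n ↦ f x) g.mul_inv
    refine ⟨fun x y ↦ ?_, ?_⟩
    · rw [← hg, key, key]
    · have := LinearMap.det_comp ((g : V n →L[ℝ] V n) : V n →ₗ[ℝ] V n)
        ((g⁻¹ : GLV n).val : V n →ₗ[ℝ] V n)
      rw [hg', one_mul] at this
      rw [← this]
      have h1 : ((g : V n →L[ℝ] V n) : V n →ₗ[ℝ] V n) ∘ₗ ((g⁻¹ : GLV n).val : V n →ₗ[ℝ] V n)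
        = LinearMap.id := LinearMap.ext key
      rw [h1, LinearMap.det_id]

/-- The group of linear isomorphisms of `ℝ^(n+1)` with block matrix `(1, 0; w, B)`, where
`w ∈ ℝ^n` and `B ∈ SO(n)`. -/
def euclideanGroup (n : ℕ) : Subgroup (GLV n) where
  carrier := {g | ∃ w : Fin n → ℝ, ∃ B ∈ Matrix.specialOrthogonalGroup (Fin n) ℝ, ∀ x : V n,
    (g : V n →L[ℝ] V n) x 0 = x 0 ∧
    ∀ i : Fin n, (g : V n →L[ℝ] V n) x i.succ = x 0 * w i + ∑ j : Fin n, B i j * x j.succ}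
  one_mem' := ⟨0, 1, one_mem _, fun x ↦ ⟨rfl, fun i ↦ by simp [Matrix.one_apply]⟩⟩
  mul_mem' := by
    rintro g h ⟨w, B, hB, hg⟩ ⟨w', B', hB', hh⟩
    refine ⟨fun i ↦ w i + ∑ j, B i j * w' j, B * B', mul_mem hB hB', fun x ↦ ⟨?_, fun i ↦ ?_⟩⟩
    · exact ((hg _).1).trans (hh x).1
    · change (g : V n →L[ℝ] V n) ((h : V n →L[ℝ] V n) x) i.succ = _
      rw [(hg _).2 i, (hh x).1]
      simp only [(hh x).2, Matrix.mul_apply, mul_add, Finset.sum_add_distrib, Finset.mul_sum,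
        Finset.sum_mul]
      rw [Finset.sum_comm (f := fun i_1 i_2 ↦ B i i_2 * B' i_2 i_1 * x i_1.succ)]
      simp only [← mul_assoc, add_assoc]
      simp only [mul_comm (x 0), mul_assoc]
  inv_mem' := by
    rintro g ⟨w, B, hB, hg⟩
    have key : ∀ x, (g : V n →L[ℝ] V n) ((g⁻¹ : GLV n).val x) = x := fun x ↦
      congrArg (fun f : V n →L[ℝ] V n ↦ f x) g.mul_inv
    have hBt : B.transpose * B = 1 := by
      have := (Matrix.mem_specialOrthogonalGroup_iff.1 hB).1
      exact (Matrix.mem_orthogonalGroup_iff' (Fin n) ℝ).1 this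
    refine ⟨fun i ↦ -∑ j, B j i * w j, B.transpose, ?_, fun x ↦ ?_⟩
    · rw [Matrix.mem_specialOrthogonalGroup_iff] at hB ⊢
      refine ⟨?_, by rw [Matrix.det_transpose]; exact hB.2⟩
      rw [Matrix.mem_orthogonalGroup_iff]
      simpa using hBt
    · set y := (g⁻¹ : GLV n).val x with hy
      obtain ⟨h0, hs⟩ := hg y
      rw [key x] at h0 hs
      refine ⟨h0.symm, fun i ↦ ?_⟩
      have e : ∀ j : Fin n, ∑ k, B k i * B k j = if i = j then 1 else 0 := fun j ↦ by
        have := congrFun (congrFun hBt i) j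
        simpa [Matrix.mul_apply, Matrix.one_apply] using this
      simp only [hs, Matrix.transpose_apply, h0, mul_add, Finset.sum_add_distrib, Finset.mul_sum]
      rw [Finset.sum_comm (f := fun k j ↦ B k i * (B k j * y j.succ))]
      simp only [← mul_assoc, ← Finset.sum_mul, e]
      simp only [ite_mul, one_mul, zero_mul, Finset.sum_ite_eq, Finset.mem_univ, if_true]
      rw [mul_neg, Finset.mul_sum, ← add_assoc, neg_add_eq_sub, ← Finset.sum_sub_distrib]
      rw [Finset.sum_eq_zero, zero_add]
      intro k _
      ring

/-- The group `G_l ⊆ GL(n+1)`: `SO(η_l)` for `0 < l`, the group of matrices `(1, 0; w, B)` with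
`B ∈ SO(n)` for `l = 0`, and the identity component of `SO(η_l)` for `l < 0`. -/
def G (n : ℕ) (l : ℝ) : Subgroup (GLV n) :=
  if 0 < l then SOeta n l
  else if l = 0 then euclideanGroup n
  else (Subgroup.connectedComponentOfOne (SOeta n l)).map (SOeta n l).subtype

/-- The union of all `{l} × G_l`, as a subset of `ℝ × GL(n+1)` with the subspace topology. -/
abbrev Total (n : ℕ) : Type := {p : ℝ × GLV n // p.2 ∈ G n p.1}

/-- The standard model of the simply connected `n`-dimensional space form of curvature `l`: the
quadric `x₀² + l (x₁² + ⋯ + xₙ²) = 1`, restricted to `x₀ > 0` if `l ≤ 0`, with the metric induced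
by `l⁻¹ dx₀² + dx₁² + ⋯ + dxₙ²` if `l ≠ 0` and by `dx₁² + ⋯ + dxₙ²` if `l = 0`. After rescaling
`x₀` by `1/√|l|` this is the sphere of radius `1/√l` for `0 < l` and the upper sheet of the
hyperboloid of radius `1/√(-l)` in Minkowski space for `l < 0`; for `l = 0` it is the affine
hyperplane `x₀ = 1`. -/
abbrev Model (n : ℕ) (l : ℝ) : Type :=
  {x : V n // x 0 ^ 2 + l * ∑ i : Fin n, x i.succ ^ 2 = 1 ∧ (l ≤ 0 → 0 < x 0)}

/-- The geodesic distance of the space form of curvature `l`. -/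
def modelDist (n : ℕ) (l : ℝ) (x y : Model n l) : ℝ :=
  if 0 < l then
    1 / √l * Real.arccos (x.1 0 * y.1 0 + l * ∑ i : Fin n, x.1 i.succ * y.1 i.succ)
  else if l = 0 then
    √(∑ i : Fin n, (x.1 i.succ - y.1 i.succ) ^ 2)
  else
    1 / √(-l) * Real.arcosh (x.1 0 * y.1 0 + l * ∑ i : Fin n, x.1 i.succ * y.1 i.succ)

/-- The isometry group of the space form of curvature `l`. -/
def Iso (n : ℕ) (l : ℝ) : Subgroup (Equiv.Perm (Model n l)) where
  carrier := {f | ∀ x y, modelDist n l (f x) (f y) = modelDist n l x y}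
  one_mem' := fun _ _ ↦ rfl
  mul_mem' := fun hf hg x y ↦ (hf _ _).trans (hg x y)
  inv_mem' := by
    intro f hf x y
    rw [← hf]
    simp

/-- The usual topology of the isometry group: pointwise convergence (for isometries, this is the
same as the compact-open topology). -/
instance (n : ℕ) (l : ℝ) : TopologicalSpace (Iso n l) :=
  TopologicalSpace.induced (fun f (x : Model n l) ↦ (f : Equiv.Perm (Model n l)) x) inferInstance

end SpaceForms

end

/-!
The groups `G_l` are described uniformly in `l` by the diagonal matrices `D_l = diag(l, 1, …, 1)`.
For `l ≠ 0`, preserving the form `η_l`, a multiple of `x₀ y₀ + l (x₁ y₁ + ⋯ + xₙ yₙ)`, is the same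
as preserving the dual form, which is a multiple of `D_l`: the condition reads `M D_l Mᵀ = D_l`.
For `l = 0` the same equation says that `M` is block lower triangular with orthogonal lower right
block. The Lie algebra of `G_l` consists of the matrices `A` with `A D_l` skew-symmetric and zero
diagonal; such an `A` is determined by its entries below the diagonal, and these are arbitrary, so
that the Lie algebras form a vector bundle of rank `n (n + 1) / 2` over the line, trivialized by the
shear `A i j ↦ A i j + D_l i * A j i`, `i < j`.

*The smooth bundle.* The Cayley transform `a ↦ (1 + a) (1 - a)⁻¹` identifies the unit ball of the
Lie algebra of `G_l` with a neighbourhood of `1` in `G_l`, for all `l` at once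
(`isInfinitesimal_cayleyInv`, `cayleyUnit_mem_G`). Composed with the shear, it is a slice chart for
the total space along the unit section. Moreover, cut-off Cayley transforms of families of elements
of the Lie algebras are smooth sections of the bundle. The values at `l` of smooth sections form an
open subgroup of `G_l`, hence all of `G_l`, as `G_l` is connected (`G_le_sectionValues`).
Translating by sections gives slice charts around every point (`totalAtlas`), in which the
projection to `ℝ` is linear, and the structure maps are smooth since they are restrictions of smooth
maps of the ambient manifold. Connectedness of `G_l` holds by definition for `l < 0`, and reduces to
that of the special orthogonal groups for `l ≥ 0`; these are connected since orthogonal groups are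
generated by reflections, which form a connected family.

*The isometries.* An isometry of the model preserves the form (for `l = 0`: the distances in `ℝ^n`),
and the model spans `ℝ^(n+1)`, so the isometry extends to a linear map, which is a linear expression
in the values at finitely many points (`extend`, `extend_iso_apply`). This gives a continuous
left inverse of the action of `G_l`. The extension preserves the form and has determinant `±1`, and
by continuity the determinant is `1` on the identity component, which is therefore mapped to `G_l`;
conversely `G_l` acts through the identity component, as it is connected (`range_act`).

*Failure of local triviality.* The fibres over `l > 0` are compact, while the fibre over `0`
contains all translations (`not_exists_homeomorph`).
-/

noncomputable section

/-! ### Embedded submanifolds given by slice charts -/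

open Topology Set in
/-- Variant of `ContMDiffAt.iff_comp_isImmersionAtOfComplement` relative to a set. -/
lemma ContMDiffWithinAt.of_comp_isImmersionAtOfComplement {E E' E'' F H H' H'' M N N' : Type*}
    [NormedAddCommGroup E] [NormedSpace ℝ E] [NormedAddCommGroup E'] [NormedSpace ℝ E']
    [NormedAddCommGroup E''] [NormedSpace ℝ E''] [NormedAddCommGroup F] [NormedSpace ℝ F]
    [TopologicalSpace H] [TopologicalSpace H'] [TopologicalSpace H'']
    {I : ModelWithCorners ℝ E H} {I' : ModelWithCorners ℝ E' H'} {I'' : ModelWithCorners ℝ E'' H''}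
    [TopologicalSpace M] [ChartedSpace H M] [TopologicalSpace N] [ChartedSpace H' N]
    [TopologicalSpace N'] [ChartedSpace H'' N'] {n : WithTop ℕ∞}
    {f : M → N} {φ : N → N'} {s : Set M} {x : M}
    (hφ : IsImmersionAtOfComplement F I' I'' n φ (f x)) (hf : ContinuousWithinAt f s x)
    (h : ContMDiffWithinAt I I'' n (φ ∘ f) s x) : ContMDiffWithinAt I I' n f s x := by
  set A := hφ.domChart
  set B := hφ.codChart
  have hsrc : ∀ᶠ y in 𝓝[s] x, f y ∈ A.source :=
    hf (A.open_source.mem_nhds hφ.mem_domChart_source)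
  have key : ∀ z ∈ A.source, A.extend I' z = (hφ.equiv.symm (B.extend I'' (φ z))).1 := by
    intro z hz
    have hz' : A.extend I' z ∈ (A.extend I').target :=
      (A.extend I').map_source (by rwa [A.extend_source])
    have h1 := hφ.writtenInCharts hz'
    simp only [Function.comp_apply] at h1
    rw [A.extend_left_inv hz] at h1
    rw [h1, ContinuousLinearEquiv.symm_apply_apply]
  have h1 : ContMDiffWithinAt I 𝓘(ℝ, E'') n (fun y ↦ B.extend I'' (φ (f y))) s x :=
    (hφ.codChart.contMDiffAt_extend hφ.codChart_mem_maximalAtlas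
      hφ.mem_codChart_source).comp_contMDiffWithinAt x h
  have h2 : ContMDiffWithinAt I 𝓘(ℝ, E') n
      (fun y ↦ (hφ.equiv.symm (B.extend I'' (φ (f y)))).1) s x := by
    have : ContMDiff 𝓘(ℝ, E'') 𝓘(ℝ, E') n (fun z ↦ (hφ.equiv.symm z).1) := by
      rw [contMDiff_iff_contDiff]; fun_prop
    exact (this _).comp_contMDiffWithinAt x h1
  have h3 : ContMDiffWithinAt I 𝓘(ℝ, E') n (fun y ↦ A.extend I' (f y)) s x := by
    refine h2.congr_of_eventuallyEq (hsrc.mono fun y hy ↦ key _ hy) ?_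
    exact key _ hφ.mem_domChart_source
  rw [contMDiffWithinAt_iff_target_of_mem_maximalAtlas hφ.domChart_mem_maximalAtlas
    hφ.mem_domChart_source]
  exact ⟨hf, h3⟩

section Slice

variable {E E' F G N : Type*}
  [NormedAddCommGroup E] [NormedSpace ℝ E] [NormedAddCommGroup E'] [NormedSpace ℝ E']
  [NormedAddCommGroup F] [NormedSpace ℝ F] [TopologicalSpace G] [TopologicalSpace N]
  {J : ModelWithCorners ℝ E' G}

/-- A chart `Ψ` of `N` is a slice chart for the subset `{p | P p}` if this subset corresponds to
`E × 0` in this chart, with respect to an identification `L` of the model space with `E × F`. -/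
def IsSliceChart (J : ModelWithCorners ℝ E' G) (L : (E × F) ≃L[ℝ] E') (P : N → Prop)
    (Ψ : OpenPartialHomeomorph N G) : Prop :=
  ∀ p ∈ Ψ.source, P p ↔ (L.symm (Ψ.extend J p)).2 = 0

lemma IsSliceChart.symm_mem {L : (E × F) ≃L[ℝ] E'} {P : N → Prop}
    {Ψ : OpenPartialHomeomorph N G} (h : IsSliceChart J L P Ψ) {u : E}
    (hu : L (u, 0) ∈ (Ψ.extend J).target) : P ((Ψ.extend J).symm (L (u, 0))) := by
  have := (Ψ.extend J).map_target hu
  rw [Ψ.extend_source] at this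
  rw [h _ this, (Ψ.extend J).right_inv hu, L.symm_apply_apply]

lemma IsSliceChart.apply_eq {L : (E × F) ≃L[ℝ] E'} {P : N → Prop}
    {Ψ : OpenPartialHomeomorph N G} (h : IsSliceChart J L P Ψ) {p : N} (hp : p ∈ Ψ.source)
    (hP : P p) : L ((L.symm (Ψ.extend J p)).1, 0) = Ψ.extend J p := by
  rw [← (h p hp).1 hP, Prod.mk.eta, L.apply_symm_apply]

open Classical in
/-- The chart of a subset `{p | P p}` induced by a slice chart. The argument `s₀` only
provides a value of the inverse outside of the target. -/
def sliceChart [J.Boundaryless] (L : (E × F) ≃L[ℝ] E') {P : N → Prop}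
    (Ψ : OpenPartialHomeomorph N G)
    (h : IsSliceChart J L P Ψ) (s₀ : Subtype P) : OpenPartialHomeomorph (Subtype P) E where
  toFun s := (L.symm (Ψ.extend J s)).1
  invFun u := if hu : P ((Ψ.extend J).symm (L (u, 0))) then ⟨_, hu⟩ else s₀
  source := Subtype.val ⁻¹' Ψ.source
  target := (fun u ↦ L (u, 0)) ⁻¹' (Ψ.extend J).target
  map_source' s hs := by
    rw [Set.mem_preimage, h.apply_eq hs s.2]
    exact (Ψ.extend J).map_source (by rwa [Ψ.extend_source])
  map_target' u hu := by
    rw [Set.mem_preimage, dif_pos (h.symm_mem hu), ← Ψ.extend_source (I := J)]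
    exact (Ψ.extend J).map_target hu
  left_inv' s hs := by
    have e : (Ψ.extend J).symm (L ((L.symm (Ψ.extend J s)).1, 0)) = s := by
      rw [h.apply_eq hs s.2, Ψ.extend_left_inv hs]
    have : P ((Ψ.extend J).symm (L ((L.symm (Ψ.extend J s)).1, 0))) := by rw [e]; exact s.2
    rw [dif_pos this]
    exact Subtype.ext e
  right_inv' u hu := by
    rw [dif_pos (h.symm_mem hu)]
    change (L.symm (Ψ.extend J ((Ψ.extend J).symm (L (u, 0))))).1 = u
    rw [(Ψ.extend J).right_inv hu, L.symm_apply_apply]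
  open_source := Ψ.open_source.preimage continuous_subtype_val
  open_target := (Ψ.isOpen_extend_target).preimage (by fun_prop)
  continuousOn_toFun := by
    have h1 : ContinuousOn (Ψ.extend J) Ψ.source := by
      rw [← Ψ.extend_source (I := J)]; exact Ψ.continuousOn_extend
    have h2 : ContinuousOn (fun s : Subtype P ↦ Ψ.extend J s) (Subtype.val ⁻¹' Ψ.source) :=
      h1.comp continuous_subtype_val.continuousOn (fun _ hs ↦ hs)
    exact (continuous_fst.comp L.symm.continuous).comp_continuousOn h2
  continuousOn_invFun := by
    refine Topology.IsInducing.subtypeVal.continuousOn_iff.2 ?_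
    have h1 : ContinuousOn (fun u ↦ (Ψ.extend J).symm (L (u, 0)))
        ((fun u ↦ L (u, 0)) ⁻¹' (Ψ.extend J).target) :=
      Ψ.continuousOn_extend_symm.comp (by fun_prop) (fun _ hu ↦ hu)
    refine h1.congr fun u hu ↦ ?_
    simp only [Function.comp_apply]
    rw [dif_pos (h.symm_mem hu)]

lemma sliceChart_apply [J.Boundaryless] (L : (E × F) ≃L[ℝ] E') {P : N → Prop}
    (Ψ : OpenPartialHomeomorph N G) (h : IsSliceChart J L P Ψ) (s₀ s : Subtype P) :
    sliceChart L Ψ h s₀ s = (L.symm (Ψ.extend J s)).1 := rfl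

lemma sliceChart_symm_apply [J.Boundaryless] (L : (E × F) ≃L[ℝ] E') {P : N → Prop}
    (Ψ : OpenPartialHomeomorph N G) (h : IsSliceChart J L P Ψ) (s₀ : Subtype P) {u : E}
    (hu : L (u, 0) ∈ (Ψ.extend J).target) :
    (((sliceChart L Ψ h s₀).symm u : Subtype P) : N) = (Ψ.extend J).symm (L (u, 0)) := by
  refine congrArg Subtype.val (dif_pos (h.symm_mem hu) :
    (sliceChart L Ψ h s₀).symm u = ⟨_, h.symm_mem hu⟩)

variable [ChartedSpace G N]

/-- A choice of a slice chart of `N` around every point of the subset `{p | P p}`. -/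
structure SliceAtlas (J : ModelWithCorners ℝ E' G) (L : (E × F) ≃L[ℝ] E') (P : N → Prop) where
  /-- The slice chart around a point. -/
  chart : Subtype P → OpenPartialHomeomorph N G
  mem_source : ∀ s : Subtype P, (s : N) ∈ (chart s).source
  isSliceChart : ∀ s, IsSliceChart J L P (chart s)
  mem_maximalAtlas : ∀ s, chart s ∈ IsManifold.maximalAtlas J ∞ N

namespace SliceAtlas

variable [J.Boundaryless] {L : (E × F) ≃L[ℝ] E'} {P : N → Prop} (A : SliceAtlas J L P)

/-- The charts of the subset `{p | P p}` induced by a family of slice charts. -/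
@[reducible] def chartedSpace : ChartedSpace E (Subtype P) where
  atlas := Set.range fun s ↦ sliceChart L (A.chart s) (A.isSliceChart s) s
  chartAt s := sliceChart L (A.chart s) (A.isSliceChart s) s
  mem_chart_source s := A.mem_source s
  chart_mem_atlas s := ⟨s, rfl⟩

lemma isManifold :
    letI := A.chartedSpace
    IsManifold 𝓘(ℝ, E) ∞ (Subtype P) := by
  let := A.chartedSpace
  refine isManifold_of_contDiffOn _ _ _ ?_
  rintro _ _ ⟨s, rfl⟩ ⟨t, rfl⟩
  simp only [modelWithCornersSelf_coe, modelWithCornersSelf_coe_symm, Function.id_comp,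
    Function.comp_id, Set.preimage_id_eq, id_eq, Set.range_id, Set.inter_univ]
  have hc := ModelWithCorners.contDiffOn_extendCoordChange (A.mem_maximalAtlas s)
    (A.mem_maximalAtlas t)
  have h1 : ContDiff ℝ ∞ (fun u : E ↦ L (u, 0)) := by fun_prop
  have h2 : ContDiff ℝ ∞ (fun z : E' ↦ (L.symm z).1) := by fun_prop
  have h3 := h2.comp_contDiffOn (hc.comp h1.contDiffOn
    (s := ((sliceChart L (A.chart s) (A.isSliceChart s) s).symm ≫ₕ
      sliceChart L (A.chart t) (A.isSliceChart t) t).source) ?_)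
  · refine h3.congr ?_
    rintro u ⟨hu, hu'⟩
    have hu2 : L (u, 0) ∈ ((A.chart s).extend J).target := hu
    simp only [OpenPartialHomeomorph.coe_trans, Function.comp_apply]
    rw [sliceChart_apply, sliceChart_symm_apply _ _ _ _ hu2]
    rfl
  · rintro u ⟨hu, hu'⟩
    have hu2 : L (u, 0) ∈ ((A.chart s).extend J).target := hu
    have hu3 : ((sliceChart L (A.chart s) (A.isSliceChart s) s).symm u : N) ∈
      (A.chart t).source := hu'
    rw [sliceChart_symm_apply _ _ _ _ hu2] at hu3
    refine ⟨hu2, ?_⟩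
    rw [Set.mem_preimage, (A.chart t).extend_source]
    exact hu3

lemma sliceChart_mem_maximalAtlas (s : Subtype P) :
    letI := A.chartedSpace
    sliceChart L (A.chart s) (A.isSliceChart s) s ∈
      IsManifold.maximalAtlas 𝓘(ℝ, E) ∞ (Subtype P) := by
  let := A.chartedSpace
  have := A.isManifold
  exact IsManifold.chart_mem_maximalAtlas (I := 𝓘(ℝ, E)) (n := ∞) s

lemma isImmersionOfComplement_val :
    letI := A.chartedSpace
    IsImmersionOfComplement F 𝓘(ℝ, E) J ∞ (Subtype.val : Subtype P → N) := by
  let := A.chartedSpace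
  intro s
  refine IsImmersionAtOfComplement.mk_of_charts L _ (A.chart s) (A.mem_source s) (A.mem_source s)
    (A.sliceChart_mem_maximalAtlas s) (A.mem_maximalAtlas s) subset_rfl ?_
  intro u hu
  have hu2 : L (u, 0) ∈ ((A.chart s).extend J).target := by
    have hu1 : u ∈ (sliceChart L (A.chart s) (A.isSliceChart s) s).target := by
      simpa [OpenPartialHomeomorph.extend] using hu
    exact hu1
  have e := sliceChart_symm_apply L (A.chart s) (A.isSliceChart s) s hu2
  simp only [Function.comp_apply]
  rw [← ((A.chart s).extend J).right_inv hu2, ← e]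
  rfl

lemma isSmoothEmbedding_val :
    letI := A.chartedSpace
    IsSmoothEmbedding 𝓘(ℝ, E) J ∞ (Subtype.val : Subtype P → N) := by
  let := A.chartedSpace
  exact ⟨A.isImmersionOfComplement_val.isImmersion, Topology.IsEmbedding.subtypeVal⟩

end SliceAtlas

end Slice

/-! ### The Cayley transform -/

/-- A map into the units of a complete normed algebra is smooth if it is smooth as a map into
the algebra. -/
lemma ContMDiffWithinAt.of_units_val {R : Type*} [NormedRing R] [CompleteSpace R]
    [NormedAlgebra ℝ R] {E H M : Type*} [NormedAddCommGroup E] [NormedSpace ℝ E]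
    [TopologicalSpace H] {I : ModelWithCorners ℝ E H} [TopologicalSpace M] [ChartedSpace H M]
    {n : WithTop ℕ∞} {f : M → Rˣ} {s : Set M} {x : M}
    (h : ContMDiffWithinAt I 𝓘(ℝ, R) n (fun y ↦ (f y : R)) s x) :
    ContMDiffWithinAt I 𝓘(ℝ, R) n f s x := by
  rw [contMDiffWithinAt_iff_target]
  refine ⟨?_, h⟩
  exact (Units.isOpenEmbedding_val.isInducing.continuousWithinAt_iff).2 h.continuousWithinAt

section Cayley

variable {R : Type*} [Ring R]

/-- The Cayley transform `(1 + a) (1 - a)⁻¹`; it is only meaningful if `1 - a` is invertible. -/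
def cayley (a : R) : R := (1 + a) * Ring.inverse (1 - a)

/-- The inverse `(g - 1) (g + 1)⁻¹` of the Cayley transform; it is only meaningful if `g + 1` is
invertible. -/
def cayleyInv (g : R) : R := (g - 1) * Ring.inverse (g + 1)

lemma cayley_mul {a : R} (h : IsUnit (1 - a)) : cayley a * (1 - a) = 1 + a := by
  rw [cayley, mul_assoc, Ring.inverse_mul_cancel _ h, mul_one]

lemma mul_cayley {a : R} (h : IsUnit (1 - a)) : (1 - a) * cayley a = 1 + a := by
  rw [cayley, ← mul_assoc, (by noncomm_ring : (1 - a) * (1 + a) = (1 + a) * (1 - a)), mul_assoc,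
    Ring.mul_inverse_cancel _ h, mul_one]

lemma cayleyInv_mul {g : R} (h : IsUnit (g + 1)) : cayleyInv g * (g + 1) = g - 1 := by
  rw [cayleyInv, mul_assoc, Ring.inverse_mul_cancel _ h, mul_one]

lemma mul_cayleyInv {g : R} (h : IsUnit (g + 1)) : (g + 1) * cayleyInv g = g - 1 := by
  rw [cayleyInv, ← mul_assoc, (by noncomm_ring : (g + 1) * (g - 1) = (g - 1) * (g + 1)), mul_assoc,
    Ring.mul_inverse_cancel _ h, mul_one]

lemma isUnit_cayley {a : R} (h : IsUnit (1 - a)) (h' : IsUnit (1 + a)) : IsUnit (cayley a) := by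
  exact h'.mul h.ringInverse

variable [Algebra ℝ R]

lemma isUnit_two_of_algebra_real : IsUnit (2 : R) := by
  have : IsUnit (algebraMap ℝ R 2) := (IsUnit.mk0 (2 : ℝ) two_ne_zero).map _
  rwa [map_ofNat] at this

lemma isUnit_cayley_add_one {a : R} (h : IsUnit (1 - a)) : IsUnit (cayley a + 1) := by
  have h1 : (cayley a + 1) * (1 - a) = 2 := by
    rw [add_mul, cayley_mul h, one_mul, ← one_add_one_eq_two]; abel
  have := isUnit_two_of_algebra_real (R := R)
  rw [← h1] at this
  obtain ⟨u, hu⟩ := h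
  rwa [← hu, Units.isUnit_mul_units] at this

lemma isUnit_one_sub_cayleyInv {g : R} (h : IsUnit (g + 1)) : IsUnit (1 - cayleyInv g) := by
  have h1 : (1 - cayleyInv g) * (g + 1) = 2 := by
    rw [sub_mul, cayleyInv_mul h, one_mul, ← one_add_one_eq_two]; abel
  have := isUnit_two_of_algebra_real (R := R)
  rw [← h1] at this
  obtain ⟨u, hu⟩ := h
  rwa [← hu, Units.isUnit_mul_units] at this

lemma cayleyInv_cayley {a : R} (h : IsUnit (1 - a)) : cayleyInv (cayley a) = a := by
  have h1 := isUnit_cayley_add_one h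
  apply h1.mul_right_cancel
  rw [cayleyInv_mul h1]
  apply h.mul_right_cancel
  rw [sub_mul, mul_assoc, add_mul, cayley_mul h]
  noncomm_ring

lemma cayley_cayleyInv {g : R} (h : IsUnit (g + 1)) : cayley (cayleyInv g) = g := by
  have h1 := isUnit_one_sub_cayleyInv h
  apply h1.mul_right_cancel
  rw [cayley_mul h1]
  apply h.mul_right_cancel
  rw [add_mul, mul_assoc, sub_mul, cayleyInv_mul h]
  noncomm_ring

end Cayley

section NormedCayley

variable {R : Type*} [NormedRing R] [CompleteSpace R]

lemma isUnit_one_sub_of_norm_lt {a : R} (h : ‖a‖ < 1) : IsUnit (1 - a) :=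
  ⟨Units.oneSub a h, Units.val_oneSub a h⟩

lemma isUnit_one_add_of_norm_lt {a : R} (h : ‖a‖ < 1) : IsUnit (1 + a) := by
  have := isUnit_one_sub_of_norm_lt (a := -a) (by rwa [norm_neg])
  rwa [sub_neg_eq_add] at this

open Classical in
/-- The Cayley transform of `a` as a unit. It is only meaningful if `cayley a` is invertible, which
is the case for `‖a‖ < 1`. -/
def cayleyUnit (a : R) : Rˣ := if h : IsUnit (cayley a) then h.unit else 1

lemma val_cayleyUnit {a : R} (h : ‖a‖ < 1) : (cayleyUnit a : R) = cayley a := by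
  rw [cayleyUnit, dif_pos (isUnit_cayley (isUnit_one_sub_of_norm_lt h)
    (isUnit_one_add_of_norm_lt h)), IsUnit.unit_spec]

@[simp] lemma cayleyUnit_zero : cayleyUnit (0 : R) = 1 := by
  ext
  rw [val_cayleyUnit (by simp), cayley]
  simp

variable [NormedAlgebra ℝ R]

lemma contDiffAt_cayley {a : R} (h : IsUnit (1 - a)) : ContDiffAt ℝ ∞ cayley a := by
  obtain ⟨u, hu⟩ := h
  have : ContDiffAt ℝ ∞ (fun a : R ↦ Ring.inverse (1 - a)) a := by
    have h1 := contDiffAt_ringInverse ℝ (n := ∞) u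
    rw [hu] at h1
    exact ContDiffAt.comp (f := fun a : R ↦ 1 - a) a h1 (by fun_prop)
  exact ContDiffAt.mul (by fun_prop) this

lemma contDiffAt_cayleyInv {g : R} (h : IsUnit (g + 1)) : ContDiffAt ℝ ∞ cayleyInv g := by
  obtain ⟨u, hu⟩ := h
  have : ContDiffAt ℝ ∞ (fun a : R ↦ Ring.inverse (a + 1)) g := by
    have h1 := contDiffAt_ringInverse ℝ (n := ∞) u
    rw [hu] at h1
    exact ContDiffAt.comp (f := fun a : R ↦ a + 1) g h1 (by fun_prop)
  exact ContDiffAt.mul (by fun_prop) this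

lemma isOpen_cayley_source :
    IsOpen {g : Rˣ | IsUnit ((g : R) + 1) ∧ ‖cayleyInv (g : R)‖ < 1} := by
  have h1 : IsOpen {g : Rˣ | IsUnit ((g : R) + 1)} :=
    Units.isOpen.preimage (f := fun g : Rˣ ↦ (g : R) + 1)
      (Units.continuous_val.add continuous_const)
  have h2 : ContinuousOn (fun g : Rˣ ↦ ‖cayleyInv (g : R)‖) {g : Rˣ | IsUnit ((g : R) + 1)} := by
    intro g hg
    refine ContinuousAt.continuousWithinAt (ContinuousAt.norm ?_)
    exact (contDiffAt_cayleyInv hg).continuousAt.comp Units.continuous_val.continuousAt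
  exact h2.isOpen_inter_preimage h1 isOpen_Iio

/-- The Cayley transform as a chart of the group of units around `1`, onto the unit ball. -/
def cayleyChart : OpenPartialHomeomorph Rˣ R where
  toFun g := cayleyInv (g : R)
  invFun := cayleyUnit
  source := {g | IsUnit ((g : R) + 1) ∧ ‖cayleyInv (g : R)‖ < 1}
  target := {a | ‖a‖ < 1}
  map_source' g hg := hg.2
  map_target' a ha := by
    have h := isUnit_one_sub_of_norm_lt ha
    refine ⟨?_, ?_⟩
    · rw [val_cayleyUnit ha]; exact isUnit_cayley_add_one h
    · rw [val_cayleyUnit ha, cayleyInv_cayley h]; exact ha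
  left_inv' g hg := by
    ext
    rw [val_cayleyUnit hg.2, cayley_cayleyInv hg.1]
  right_inv' a ha := by
    rw [val_cayleyUnit ha, cayleyInv_cayley (isUnit_one_sub_of_norm_lt ha)]
  open_source := isOpen_cayley_source
  open_target := isOpen_lt continuous_norm continuous_const
  continuousOn_toFun g hg :=
    ((contDiffAt_cayleyInv hg.1).continuousAt.comp
      Units.continuous_val.continuousAt).continuousWithinAt
  continuousOn_invFun := by
    rw [Units.isOpenEmbedding_val.isInducing.continuousOn_iff]
    refine ContinuousOn.congr (f := cayley) ?_ fun a ha ↦ val_cayleyUnit ha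
    exact fun a ha ↦
      (contDiffAt_cayley (isUnit_one_sub_of_norm_lt ha)).continuousAt.continuousWithinAt

lemma contMDiffOn_cayleyChart :
    ContMDiffOn 𝓘(ℝ, R) 𝓘(ℝ, R) ∞ (cayleyChart (R := R)) (cayleyChart (R := R)).source :=
  fun g hg ↦ (ContMDiffAt.comp g (contDiffAt_cayleyInv hg.1).contMDiffAt
    (Units.contMDiff_val g)).contMDiffWithinAt

lemma contMDiffOn_cayleyChart_symm :
    ContMDiffOn 𝓘(ℝ, R) 𝓘(ℝ, R) ∞ (cayleyChart (R := R)).symm (cayleyChart (R := R)).target := by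
  intro a ha
  apply ContMDiffWithinAt.of_units_val
  refine ContMDiffWithinAt.congr (f := cayley) ?_ (fun b hb ↦ val_cayleyUnit hb)
    (val_cayleyUnit ha)
  exact (contDiffAt_cayley (isUnit_one_sub_of_norm_lt ha)).contMDiffAt.contMDiffWithinAt

lemma continuousOn_cayleyUnit : ContinuousOn (cayleyUnit (R := R)) {a | ‖a‖ < 1} :=
  (cayleyChart (R := R)).continuousOn_symm

lemma cayleyChart_apply (g : Rˣ) : cayleyChart g = cayleyInv (g : R) := rfl

lemma cayleyChart_symm_apply (a : R) : cayleyChart.symm a = cayleyUnit a := rfl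

lemma one_mem_cayleyChart_source : (1 : Rˣ) ∈ (cayleyChart (R := R)).source := by
  refine ⟨?_, ?_⟩
  · rw [Units.val_one, one_add_one_eq_two]; exact isUnit_two_of_algebra_real
  · simp [cayleyInv]

end NormedCayley

namespace SpaceForms

variable {n : ℕ} {l : ℝ}

-- Shortcuts for instances whose general search is slow.
local instance completeSpace_end (n : ℕ) : CompleteSpace (V n →L[ℝ] V n) := inferInstance

local instance chartedSpace_GLV (n : ℕ) : ChartedSpace (V n →L[ℝ] V n) (GLV n) := inferInstance

/-! ### The groups in terms of matrices -/

/-- The matrix of an endomorphism of `ℝ^(n+1)`. -/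
def mat : (V n →L[ℝ] V n) ≃⋆ₐ[ℝ] Matrix (Fin (n + 1)) (Fin (n + 1)) ℝ :=
  Matrix.toEuclideanCLM.symm

lemma mat_symm_apply (M : Matrix (Fin (n + 1)) (Fin (n + 1)) ℝ) (x : V n) (i : Fin (n + 1)) :
    (mat.symm M : V n →L[ℝ] V n) x i = ∑ j, M i j * x j := rfl

lemma apply_eq_sum (T : V n →L[ℝ] V n) (x : V n) (i : Fin (n + 1)) :
    T x i = ∑ j, mat T i j * x j := by
  rw [← mat_symm_apply, StarAlgEquiv.symm_apply_apply]

lemma mat_apply (T : V n →L[ℝ] V n) (i j : Fin (n + 1)) :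
    mat T i j = T (EuclideanSpace.single j 1) i := by
  rw [apply_eq_sum]
  simp [PiLp.single_apply]

lemma det_eq_det_mat (T : V n →L[ℝ] V n) :
    LinearMap.det (T : V n →ₗ[ℝ] V n) = (mat T).det := by
  obtain ⟨M, rfl⟩ : ∃ M, mat.symm M = T := ⟨mat T, mat.symm_apply_apply T⟩
  rw [StarAlgEquiv.apply_symm_apply]
  change LinearMap.det (Matrix.toEuclideanCLM (𝕜 := ℝ) M : V n →ₗ[ℝ] V n) = _
  rw [Matrix.coe_toEuclideanCLM_eq_toEuclideanLin]
  exact LinearMap.det_toLin (PiLp.basisFun 2 ℝ (Fin (n + 1))) M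

lemma continuous_mat : Continuous (mat (n := n)) :=
  LinearMap.continuous_of_finiteDimensional
    (⟨⟨mat (n := n), map_add _⟩, map_smul _⟩ :
      (V n →L[ℝ] V n) →ₗ[ℝ] Matrix (Fin (n + 1)) (Fin (n + 1)) ℝ)

lemma continuous_mat_symm : Continuous (mat (n := n)).symm :=
  LinearMap.continuous_of_finiteDimensional
    (⟨⟨(mat (n := n)).symm, map_add _⟩, map_smul _⟩ :
      Matrix (Fin (n + 1)) (Fin (n + 1)) ℝ →ₗ[ℝ] (V n →L[ℝ] V n))

/-- The diagonal of the form `x₀ y₀ + l (x₁ y₁ + ⋯ + xₙ yₙ)`. -/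
def formDiag (l : ℝ) : Fin (n + 1) → ℝ := Fin.cons 1 fun _ ↦ l

/-- The diagonal of the dual form, up to scaling: `(l, 1, …, 1)`. -/
def dualDiag (l : ℝ) : Fin (n + 1) → ℝ := Fin.cons l fun _ ↦ 1

@[simp] lemma formDiag_zero : formDiag (n := n) l 0 = 1 := rfl
@[simp] lemma formDiag_succ (i : Fin n) : formDiag l i.succ = l := rfl
@[simp] lemma dualDiag_zero : dualDiag (n := n) l 0 = l := rfl
@[simp] lemma dualDiag_succ (i : Fin n) : dualDiag l i.succ = 1 := rfl

lemma formDiag_mul_dualDiag (i : Fin (n + 1)) : formDiag l i * dualDiag l i = l := by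
  induction i using Fin.cases <;> simp

/-- The form `x₀ y₀ + l (x₁ y₁ + ⋯ + xₙ yₙ)`. -/
def form (l : ℝ) (x y : V n) : ℝ := x 0 * y 0 + l * ∑ i : Fin n, x i.succ * y i.succ

lemma form_eq_sum (x y : V n) : form l x y = ∑ i, formDiag l i * (x i * y i) := by
  rw [Fin.sum_univ_succ, form]
  simp [Finset.mul_sum]

/-- The form `η_l` is a nonzero multiple of `x₀ y₀ + l (x₁ y₁ + ⋯ + xₙ yₙ)`. -/
lemma exists_eta_eq_mul_form (hl : l ≠ 0) :
    ∃ c : ℝ, c ≠ 0 ∧ ∀ x y : V n, eta n l x y = c * form l x y := by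
  rcases hl.lt_or_gt with h | h
  · have h0 : 0 < √(-l) := Real.sqrt_pos.2 (by linarith)
    refine ⟨-1 / √(-l), by simp [h0.ne'], fun x y ↦ ?_⟩
    have h1 : √(-l) = -1 / √(-l) * l := by
      field_simp
      rw [Real.sq_sqrt (by linarith)]
    rw [eta, if_neg (not_lt.2 h.le), form, mul_add, ← mul_assoc _ l, ← h1]
  · have h0 : 0 < √l := Real.sqrt_pos.2 h
    refine ⟨1 / √l, by simp [h0.ne'], fun x y ↦ ?_⟩
    have h1 : √l = 1 / √l * l := by
      field_simp
      rw [Real.sq_sqrt h.le]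
    rw [eta, if_pos h, form, mul_add, ← mul_assoc _ l, ← h1]

/-- The matrices preserving the form `x₀ y₀ + l (x₁ y₁ + ⋯ + xₙ yₙ)`. -/
def PreservesForm (l : ℝ) (M : Matrix (Fin (n + 1)) (Fin (n + 1)) ℝ) : Prop :=
  M.transpose * Matrix.diagonal (formDiag l) * M = Matrix.diagonal (formDiag l)

lemma form_eq_dotProduct (x y : V n) :
    form l x y = x.ofLp ⬝ᵥ (Matrix.diagonal (formDiag l)).mulVec y.ofLp := by
  rw [form_eq_sum, dotProduct]
  refine Finset.sum_congr rfl fun i _ ↦ ?_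
  rw [Matrix.mulVec_diagonal]
  ring

lemma ofLp_apply (T : V n →L[ℝ] V n) (x : V n) : (T x).ofLp = (mat T).mulVec x.ofLp := by
  ext i
  exact apply_eq_sum T x i

lemma form_apply (T : V n →L[ℝ] V n) (x y : V n) :
    form l (T x) (T y) = x.ofLp ⬝ᵥ
      ((mat T).transpose * Matrix.diagonal (formDiag l) * mat T).mulVec y.ofLp := by
  rw [form_eq_dotProduct, ofLp_apply, ofLp_apply, Matrix.mulVec_mulVec, mul_assoc,
    ← Matrix.mulVec_mulVec (M := (mat T).transpose), Matrix.dotProduct_mulVec _ (mat T).transpose,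
    Matrix.vecMul_transpose]

lemma preservesForm_mat_iff (T : V n →L[ℝ] V n) :
    PreservesForm l (mat T) ↔ ∀ x y, form l (T x) (T y) = form l x y := by
  constructor
  · intro h x y
    rw [form_apply, h, form_eq_dotProduct]
  · intro h
    ext i j
    have := h (EuclideanSpace.single i 1) (EuclideanSpace.single j 1)
    rw [form_apply, form_eq_dotProduct] at this
    rcases eq_or_ne i j with rfl | hij
    · simpa using this
    · simpa [Matrix.diagonal_apply, hij, hij.symm] using this

lemma mem_SOeta_iff (hl : l ≠ 0) (g : GLV n) :
    g ∈ SOeta n l ↔ PreservesForm l (mat (g : V n →L[ℝ] V n)) ∧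
      (mat (g : V n →L[ℝ] V n)).det = 1 := by
  obtain ⟨c, hc, h⟩ := exists_eta_eq_mul_form (n := n) hl
  rw [preservesForm_mat_iff, ← det_eq_det_mat]
  change ((∀ x y, _) ∧ _) ↔ _
  simp only [h, mul_right_inj' hc]

lemma PreservesForm.det_sq {M : Matrix (Fin (n + 1)) (Fin (n + 1)) ℝ} (hl : l ≠ 0)
    (h : PreservesForm l M) : M.det = 1 ∨ M.det = -1 := by
  have h1 := congrArg Matrix.det h
  rw [Matrix.det_mul, Matrix.det_mul, Matrix.det_transpose, Matrix.det_diagonal,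
    Fin.prod_univ_succ] at h1
  simp only [formDiag_zero, formDiag_succ, Finset.prod_const, one_mul] at h1
  have h2 : l ^ (Finset.univ : Finset (Fin n)).card ≠ 0 := pow_ne_zero _ hl
  rw [← mul_self_eq_one_iff]
  exact mul_right_cancel₀ h2 (by linear_combination h1)

/-- The matrices preserving the form with matrix `diag(l, 1, …, 1)` on the dual space. For `l ≠ 0`
this is equivalent to `PreservesForm`. For `l = 0`, where `PreservesForm` says nothing about the
lower right block, it says that the matrix is block lower triangular with orthogonal lower right
block. -/
def PreservesDual (l : ℝ) (M : Matrix (Fin (n + 1)) (Fin (n + 1)) ℝ) : Prop :=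
  M * Matrix.diagonal (dualDiag l) * M.transpose = Matrix.diagonal (dualDiag l)

lemma diagonal_formDiag_mul_dualDiag :
    Matrix.diagonal (formDiag (n := n) l) * Matrix.diagonal (dualDiag l) =
      l • (1 : Matrix (Fin (n + 1)) (Fin (n + 1)) ℝ) := by
  rw [Matrix.diagonal_mul_diagonal, ← Matrix.diagonal_one, ← Matrix.diagonal_smul]
  congr 1
  ext i
  simp [formDiag_mul_dualDiag]

lemma diagonal_dualDiag_mul_formDiag :
    Matrix.diagonal (dualDiag (n := n) l) * Matrix.diagonal (formDiag l) =
      l • (1 : Matrix (Fin (n + 1)) (Fin (n + 1)) ℝ) := by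
  rw [← diagonal_formDiag_mul_dualDiag, Matrix.diagonal_mul_diagonal, Matrix.diagonal_mul_diagonal]
  simp only [mul_comm]

/-- If `P Q = l` and `X ᵀ P X = P`, then `X Q Xᵀ = Q`, as `l ≠ 0`. -/
lemma mul_mul_transpose_eq_of_transpose_mul_mul {ι : Type*} [Fintype ι] [DecidableEq ι]
    {X Y P Q : Matrix ι ι ℝ} (hl : l ≠ 0) (hPQ : P * Q = l • 1) (hQP : Q * P = l • 1)
    (h : Y * P * X = P) : X * Q * Y = Q := by
  have h1 : (l⁻¹ • (Q * Y * P)) * X = 1 := by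
    rw [smul_mul_assoc, mul_assoc, mul_assoc, ← mul_assoc Y, h, hQP, smul_smul,
      inv_mul_cancel₀ hl, one_smul]
  rw [mul_eq_one_comm] at h1
  calc X * Q * Y = l⁻¹ • (X * Q * Y * (P * Q)) := by
        rw [hPQ, mul_smul_comm, mul_one, smul_smul, inv_mul_cancel₀ hl, one_smul]
    _ = (X * (l⁻¹ • (Q * Y * P))) * Q := by
        rw [mul_smul_comm, smul_mul_assoc]; simp only [mul_assoc]
    _ = Q := by rw [h1, one_mul]

lemma preservesDual_iff_preservesForm (hl : l ≠ 0) {M : Matrix (Fin (n + 1)) (Fin (n + 1)) ℝ} :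
    PreservesDual l M ↔ PreservesForm l M :=
  ⟨mul_mul_transpose_eq_of_transpose_mul_mul hl diagonal_dualDiag_mul_formDiag
    diagonal_formDiag_mul_dualDiag,
  mul_mul_transpose_eq_of_transpose_mul_mul hl diagonal_formDiag_mul_dualDiag
    diagonal_dualDiag_mul_formDiag⟩

lemma preservesDual_iff {M : Matrix (Fin (n + 1)) (Fin (n + 1)) ℝ} :
    PreservesDual l M ↔
      ∀ i j, l * (M i 0 * M j 0) + ∑ k : Fin n, M i k.succ * M j k.succ =
        if i = j then dualDiag l i else 0 := by
  rw [PreservesDual, ← Matrix.ext_iff]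
  refine forall₂_congr fun i j ↦ ?_
  rw [Matrix.mul_apply, Fin.sum_univ_succ, Matrix.diagonal_apply]
  simp only [Matrix.mul_diagonal, Matrix.transpose_apply, dualDiag_zero, dualDiag_succ, mul_one]
  rw [mul_right_comm, mul_comm]

/-- A matrix preserving the degenerate form `diag(0, 1, …, 1)` on the dual space is block lower
triangular. -/
lemma PreservesDual.apply_zero_succ {M : Matrix (Fin (n + 1)) (Fin (n + 1)) ℝ}
    (h : PreservesDual 0 M) (j : Fin n) : M 0 j.succ = 0 := by
  have h1 := preservesDual_iff.1 h 0 0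
  simp only [zero_mul, zero_add, if_true, dualDiag_zero] at h1
  have h2 := (Finset.sum_eq_zero_iff_of_nonneg fun k _ ↦ mul_self_nonneg (M 0 (Fin.succ k))).1 h1 j
    (Finset.mem_univ j)
  exact mul_self_eq_zero.1 h2

lemma PreservesDual.submatrix_mem_orthogonalGroup {M : Matrix (Fin (n + 1)) (Fin (n + 1)) ℝ}
    (h : PreservesDual 0 M) :
    M.submatrix Fin.succ Fin.succ ∈ Matrix.orthogonalGroup (Fin n) ℝ := by
  rw [Matrix.mem_orthogonalGroup_iff]
  ext i j
  have h1 := preservesDual_iff.1 h i.succ j.succ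
  simpa [Matrix.mul_apply, Matrix.one_apply, Matrix.star_apply] using h1

lemma det_eq_det_submatrix {M : Matrix (Fin (n + 1)) (Fin (n + 1)) ℝ} (h0 : M 0 0 = 1)
    (h : ∀ j : Fin n, M 0 j.succ = 0) : M.det = (M.submatrix Fin.succ Fin.succ).det := by
  rw [Matrix.det_succ_row_zero, Fin.sum_univ_succ]
  simp [h0, h]

lemma mem_euclideanGroup_iff (g : GLV n) :
    g ∈ euclideanGroup n ↔ PreservesDual 0 (mat (g : V n →L[ℝ] V n)) ∧
      mat (g : V n →L[ℝ] V n) 0 0 = 1 ∧ (mat (g : V n →L[ℝ] V n)).det = 1 := by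
  set M := mat (g : V n →L[ℝ] V n) with hM
  constructor
  · rintro ⟨w, B, hB, h⟩
    have e0 : ∀ j : Fin n, M 0 j.succ = 0 := fun j ↦ by
      rw [hM, mat_apply, (h _).1]; simp
    have e1 : M 0 0 = 1 := by rw [hM, mat_apply, (h _).1]; simp
    have e2 : M.submatrix Fin.succ Fin.succ = B := by
      ext i j
      rw [Matrix.submatrix_apply, hM, mat_apply, (h _).2]
      simp [PiLp.single_apply]
    rw [Matrix.mem_specialOrthogonalGroup_iff] at hB
    refine ⟨?_, e1, by rw [det_eq_det_submatrix e1 e0, e2, hB.2]⟩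
    rw [preservesDual_iff]
    have hB1 := (Matrix.mem_orthogonalGroup_iff _ _).1 hB.1
    intro i j
    induction i using Fin.cases with
    | zero => simp [e0, eq_comm]
    | succ i =>
      induction j using Fin.cases with
      | zero => simp [e0]
      | succ j =>
        have := congrFun (congrFun hB1 i) j
        rw [← e2] at this
        simpa [Matrix.mul_apply, Matrix.one_apply, Matrix.star_apply] using this
  · rintro ⟨h1, h2, h3⟩
    refine ⟨fun i ↦ M i.succ 0, M.submatrix Fin.succ Fin.succ, ?_, fun x ↦ ⟨?_, fun i ↦ ?_⟩⟩
    · rw [Matrix.mem_specialOrthogonalGroup_iff, ← det_eq_det_submatrix h2 h1.apply_zero_succ]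
      exact ⟨h1.submatrix_mem_orthogonalGroup, h3⟩
    · rw [apply_eq_sum, Fin.sum_univ_succ, ← hM]
      simp [h1.apply_zero_succ, h2]
    · rw [apply_eq_sum, Fin.sum_univ_succ, ← hM]
      simp [mul_comm]

lemma G_of_pos (hl : 0 < l) : G n l = SOeta n l := if_pos hl

lemma G_zero : G n 0 = euclideanGroup n := by simp [G]

lemma G_of_neg (hl : l < 0) :
    G n l = (Subgroup.connectedComponentOfOne (SOeta n l)).map (SOeta n l).subtype := by
  rw [G, if_neg (not_lt.2 hl.le), if_neg hl.ne]

lemma G_le_SOeta (hl : l ≠ 0) : G n l ≤ SOeta n l := by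
  rcases hl.lt_or_gt with h | h
  · rw [G_of_neg h]; exact Subgroup.map_subtype_le _
  · rw [G_of_pos h]

lemma preservesDual_of_mem_G {g : GLV n} (hg : g ∈ G n l) :
    PreservesDual l (mat (g : V n →L[ℝ] V n)) := by
  rcases eq_or_ne l 0 with rfl | hl
  · rw [G_zero, mem_euclideanGroup_iff] at hg
    exact hg.1
  · exact (preservesDual_iff_preservesForm hl).2 ((mem_SOeta_iff hl g).1 (G_le_SOeta hl hg)).1

/-- For `l < 0`, a connected subset of `SO(η_l)` containing `1` is contained in `G_l`. -/
lemma subset_G_of_isPreconnected (hl : l < 0) {s : Set (GLV n)} (hs : IsPreconnected s)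
    (h1 : 1 ∈ s) (h : s ⊆ SOeta n l) : s ⊆ G n l := by
  have e : (Subtype.val : SOeta n l → GLV n) '' (Subtype.val ⁻¹' s) = s := by
    refine Set.image_preimage_eq_of_subset fun g hg ↦ ⟨⟨g, h hg⟩, rfl⟩
  have hs' : IsPreconnected ((Subtype.val : SOeta n l → GLV n) ⁻¹' s) := by
    refine (Topology.IsInducing.subtypeVal.isPreconnected_image).1 ?_
    exact (congrArg IsPreconnected e).mpr hs
  intro g hg
  rw [G_of_neg hl]
  exact ⟨⟨g, h hg⟩, hs'.subset_connectedComponent (x := 1) h1 hg, rfl⟩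

/-! ### The Cayley transform of the groups -/

lemma cayleyInv_of_preserves {ι : Type*} [Fintype ι] [DecidableEq ι] {X A P : Matrix ι ι ℝ}
    (hu : IsUnit (X + 1)) (hA : (X + 1) * A = X - 1) (h : X * P * X.transpose = P) :
    A * P + P * A.transpose = 0 := by
  have hu' : IsUnit (X + 1).transpose := (Matrix.isUnit_transpose _).2 hu
  apply hu.mul_left_cancel
  apply hu'.mul_right_cancel
  have hA' : A.transpose * (X + 1).transpose = (X - 1).transpose := by
    rw [← Matrix.transpose_mul, hA]
  calc (X + 1) * (A * P + P * A.transpose) * (X + 1).transpose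
      = ((X + 1) * A) * P * (X + 1).transpose +
          (X + 1) * P * (A.transpose * (X + 1).transpose) := by
        noncomm_ring
    _ = (X - 1) * P * (X.transpose + 1) + (X + 1) * P * (X.transpose - 1) := by
        rw [hA, hA']; simp
    _ = 2 • (X * P * X.transpose) - 2 • P := by noncomm_ring
    _ = _ := by rw [h]; simp

lemma preserves_of_cayley {ι : Type*} [Fintype ι] [DecidableEq ι] {X A P : Matrix ι ι ℝ}
    (hu : IsUnit (1 - A)) (hA : (1 - A) * X = 1 + A) (h : A * P + P * A.transpose = 0) :
    X * P * X.transpose = P := by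
  have hu' : IsUnit (1 - A).transpose := (Matrix.isUnit_transpose _).2 hu
  apply hu.mul_left_cancel
  apply hu'.mul_right_cancel
  have hA' : X.transpose * (1 - A).transpose = (1 + A).transpose := by
    rw [← Matrix.transpose_mul, hA]
  calc (1 - A) * (X * P * X.transpose) * (1 - A).transpose
      = ((1 - A) * X) * P * (X.transpose * (1 - A).transpose) := by noncomm_ring
    _ = (1 + A) * P * (1 + A.transpose) := by rw [hA, hA']; simp
    _ = (1 - A) * P * (1 - A.transpose) + 2 • (A * P + P * A.transpose) := by noncomm_ring
    _ = _ := by rw [h]; simp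

/-- The Lie algebra of `G_l`: the matrices `A` with `A D` skew-symmetric, where
`D = diag(l, 1, …, 1)`, and (which only matters for `l = 0`) with zeros on the diagonal. Such a
matrix is determined by its entries below the diagonal, which are arbitrary. -/
def IsInfinitesimal (l : ℝ) (A : Matrix (Fin (n + 1)) (Fin (n + 1)) ℝ) : Prop :=
  ∀ i j, i ≤ j → A i j + (if i < j then dualDiag l i * A j i else 0) = 0

lemma IsInfinitesimal.smul {A : Matrix (Fin (n + 1)) (Fin (n + 1)) ℝ} (h : IsInfinitesimal l A)
    (c : ℝ) : IsInfinitesimal l (c • A) := by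
  intro i j hij
  have h1 := h i j hij
  simp only [Matrix.smul_apply, smul_eq_mul]
  split_ifs at h1 ⊢ <;> linear_combination c * h1

lemma IsInfinitesimal.diag {A : Matrix (Fin (n + 1)) (Fin (n + 1)) ℝ} (h : IsInfinitesimal l A)
    (i : Fin (n + 1)) : A i i = 0 := by
  simpa using h i i le_rfl

lemma dualDiag_of_lt {i j : Fin (n + 1)} (h : i < j) : dualDiag l j = 1 := by
  obtain ⟨k, rfl⟩ := Fin.exists_succ_eq.2 (Fin.ne_zero_of_lt h)
  simp

lemma IsInfinitesimal.mul_add_mul {A : Matrix (Fin (n + 1)) (Fin (n + 1)) ℝ}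
    (h : IsInfinitesimal l A) (i j : Fin (n + 1)) :
    A i j * dualDiag l j + dualDiag l i * A j i = 0 := by
  rcases lt_trichotomy i j with hij | rfl | hij
  · have := h i j hij.le
    rw [if_pos hij] at this
    rw [dualDiag_of_lt hij]
    linear_combination this
  · rw [h.diag]; ring
  · have := h j i hij.le
    rw [if_pos hij] at this
    rw [dualDiag_of_lt hij]
    linear_combination this

lemma IsInfinitesimal.mul_add_mul_transpose {A : Matrix (Fin (n + 1)) (Fin (n + 1)) ℝ}
    (h : IsInfinitesimal l A) :
    A * Matrix.diagonal (dualDiag l) + Matrix.diagonal (dualDiag l) * A.transpose = 0 := by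
  ext i j
  rw [Matrix.add_apply, Matrix.mul_diagonal, Matrix.diagonal_mul]
  exact h.mul_add_mul i j

/-- Writing `A = D K` with `K` skew-symmetric, this is `det (1 + D K) = det (1 - K D)`. -/
lemma IsInfinitesimal.det_one_add {A : Matrix (Fin (n + 1)) (Fin (n + 1)) ℝ}
    (h : IsInfinitesimal l A) : (1 + A).det = (1 - A).det := by
  let K : Matrix (Fin (n + 1)) (Fin (n + 1)) ℝ :=
    Matrix.of fun i ↦ Fin.cases (fun j ↦ -A j 0) (fun k j ↦ A k.succ j) i
  have hK : K.transpose = -K := by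
    ext i j
    induction i using Fin.cases with
    | zero =>
      induction j using Fin.cases with
      | zero => simp [K, h.diag]
      | succ j => simp [K]
    | succ i =>
      induction j using Fin.cases with
      | zero => simp [K]
      | succ j =>
        have := h.mul_add_mul i.succ j.succ
        simp only [dualDiag_succ, mul_one, one_mul] at this
        simp only [K, Matrix.transpose_apply, Matrix.of_apply, Fin.cases_succ, Matrix.neg_apply]
        linarith
  have hA : Matrix.diagonal (dualDiag l) * K = A := by
    ext i j
    rw [Matrix.diagonal_mul]
    induction i using Fin.cases with
    | zero =>
      induction j using Fin.cases with
      | zero => simp [K, h.diag]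
      | succ j =>
        have := h.mul_add_mul 0 j.succ
        simp only [dualDiag_succ, dualDiag_zero, mul_one] at this
        simp only [K, Matrix.of_apply, Fin.cases_zero, dualDiag_zero]
        linarith
    | succ i => simp [K]
  rw [← Matrix.det_transpose, Matrix.transpose_add, ← hA, Matrix.transpose_mul, hK,
    Matrix.diagonal_transpose, Matrix.transpose_one, Matrix.det_one_add_mul_comm, Matrix.mul_neg,
    sub_eq_add_neg]

/-- The inverse Cayley transform maps `G_l` to its Lie algebra. -/
lemma isInfinitesimal_cayleyInv {g : GLV n} (hg : g ∈ G n l)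
    (hu : IsUnit ((g : V n →L[ℝ] V n) + 1)) :
    IsInfinitesimal l (mat (cayleyInv (g : V n →L[ℝ] V n))) := by
  set M := mat (g : V n →L[ℝ] V n) with hM
  set A := mat (cayleyInv (g : V n →L[ℝ] V n)) with hA
  have hMA : (M + 1) * A = M - 1 := by
    have := congrArg mat (mul_cayleyInv hu)
    rwa [map_mul, map_add, map_sub, map_one] at this
  have huM : IsUnit (M + 1) := by
    have := hu.map (mat (n := n))
    rwa [map_add, map_one] at this
  have h0 := cayleyInv_of_preserves huM hMA (preservesDual_of_mem_G hg)
  have h1 : ∀ i j, A i j * dualDiag l j + dualDiag l i * A j i = 0 := fun i j ↦ by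
    have := congrFun (congrFun h0 i) j
    rwa [Matrix.add_apply, Matrix.mul_diagonal, Matrix.diagonal_mul] at this
  intro i j hij
  rcases hij.lt_or_eq with hij | rfl
  · have := h1 i j
    rw [dualDiag_of_lt hij] at this
    rw [if_pos hij]
    linear_combination this
  · simp only [lt_self_iff_false, if_false, add_zero]
    induction i using Fin.cases with
    | succ i =>
      have := h1 i.succ i.succ
      rw [dualDiag_succ] at this
      linarith
    | zero =>
      rcases eq_or_ne l 0 with rfl | hl
      · rw [G_zero, mem_euclideanGroup_iff, ← hM] at hg
        have := congrFun (congrFun hMA 0) 0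
        rw [Matrix.mul_apply, Fin.sum_univ_succ] at this
        simpa [hg.1.apply_zero_succ, hg.2.1, Matrix.one_apply, (Fin.succ_ne_zero _).symm,
          one_add_one_eq_two] using this
      · have := h1 0 0
        rw [dualDiag_zero] at this
        have h2 : l * A 0 0 = 0 := by linarith
        exact (mul_eq_zero.1 h2).resolve_left hl

lemma cayley_mul_mat {T : V n →L[ℝ] V n} (hT : ‖T‖ < 1) :
    (1 - mat T) * mat (cayleyUnit T : V n →L[ℝ] V n) = 1 + mat T := by
  have := congrArg mat (mul_cayley (isUnit_one_sub_of_norm_lt hT))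
  rwa [map_mul, map_add, map_sub, map_one, ← val_cayleyUnit hT] at this

lemma isUnit_one_sub_mat {T : V n →L[ℝ] V n} (hT : ‖T‖ < 1) : IsUnit (1 - mat T) := by
  have := (isUnit_one_sub_of_norm_lt hT).map (mat (n := n))
  rwa [map_sub, map_one] at this

lemma preservesDual_cayleyUnit {T : V n →L[ℝ] V n} (hT : ‖T‖ < 1)
    (h : IsInfinitesimal l (mat T)) :
    PreservesDual l (mat (cayleyUnit T : V n →L[ℝ] V n)) :=
  preserves_of_cayley (isUnit_one_sub_mat hT) (cayley_mul_mat hT) h.mul_add_mul_transpose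

lemma det_cayleyUnit {T : V n →L[ℝ] V n} (hT : ‖T‖ < 1) (h : IsInfinitesimal l (mat T)) :
    (mat (cayleyUnit T : V n →L[ℝ] V n)).det = 1 := by
  have h1 := congrArg Matrix.det (cayley_mul_mat hT)
  have h2 := ((Matrix.isUnit_iff_isUnit_det _).1 (isUnit_one_sub_mat hT)).ne_zero
  rw [Matrix.det_mul, h.det_one_add] at h1
  exact mul_left_cancel₀ h2 (by rw [h1, mul_one])

lemma cayleyUnit_mem_SOeta (hl : l ≠ 0) {T : V n →L[ℝ] V n} (hT : ‖T‖ < 1)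
    (h : IsInfinitesimal l (mat T)) : cayleyUnit T ∈ SOeta n l :=
  (mem_SOeta_iff hl _).2 ⟨(preservesDual_iff_preservesForm hl).1 (preservesDual_cayleyUnit hT h),
    det_cayleyUnit hT h⟩

/-- The Cayley transform maps small elements of the Lie algebra of `G_l` to `G_l`. -/
lemma cayleyUnit_mem_G {T : V n →L[ℝ] V n} (hT : ‖T‖ < 1) (h : IsInfinitesimal l (mat T)) :
    cayleyUnit T ∈ G n l := by
  rcases lt_trichotomy l 0 with hl | rfl | hl
  · -- the path `t ↦ cayleyUnit (t • T)` joins the identity to `cayleyUnit T`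
    have hn : ∀ t ∈ Set.Icc (0 : ℝ) 1, ‖t • T‖ < 1 := fun t ht ↦ by
      rw [norm_smul, Real.norm_of_nonneg ht.1]
      exact (mul_le_of_le_one_left (norm_nonneg _) ht.2).trans_lt hT
    have hc : ContinuousOn (fun t : ℝ ↦ cayleyUnit (t • T)) (Set.Icc 0 1) :=
      continuousOn_cayleyUnit.comp (by fun_prop) hn
    have := subset_G_of_isPreconnected hl (isPreconnected_Icc.image _ hc)
      ⟨0, by simp, (congrArg cayleyUnit (zero_smul ℝ T)).trans cayleyUnit_zero⟩ (by
        rintro _ ⟨t, ht, rfl⟩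
        refine cayleyUnit_mem_SOeta hl.ne (hn t ht) ?_
        rw [map_smul]
        exact h.smul t)
    exact this ⟨1, by simp, by simp⟩
  · rw [G_zero, mem_euclideanGroup_iff]
    refine ⟨preservesDual_cayleyUnit hT h, ?_, det_cayleyUnit hT h⟩
    have h0 : ∀ j, mat T 0 j = 0 := fun j ↦ by
      induction j using Fin.cases with
      | zero => exact h.diag 0
      | succ j => simpa using h 0 j.succ (Fin.zero_le _)
    have := congrFun (congrFun (cayley_mul_mat hT) 0) 0
    rw [Matrix.mul_apply, Fin.sum_univ_succ] at this
    simpa [h0, Matrix.one_apply, (Fin.succ_ne_zero _).symm] using this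
  · rw [G_of_pos hl]
    exact cayleyUnit_mem_SOeta hl.ne' hT h

/-! ### Straightening the bundle of Lie algebras -/

lemma contDiff_mat_apply (i j : Fin (n + 1)) :
    ContDiff ℝ ∞ (fun T : V n →L[ℝ] V n ↦ mat T i j) := by
  let f : (V n →L[ℝ] V n) →ₗ[ℝ] ℝ :=
    ⟨⟨fun T ↦ mat T i j, fun S T ↦ by rw [map_add]; rfl⟩,
      fun c T ↦ congrFun (congrFun (map_smul mat c T) i) j⟩
  exact (LinearMap.toContinuousLinearMap f).contDiff

lemma contDiff_mat_symm {E : Type*} [NormedAddCommGroup E] [NormedSpace ℝ E]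
    {f : E → Fin (n + 1) → Fin (n + 1) → ℝ} (hf : ∀ i j, ContDiff ℝ ∞ (fun x ↦ f x i j)) :
    ContDiff ℝ ∞ (fun x ↦ mat.symm (Matrix.of (f x))) := by
  let g : (Fin (n + 1) → Fin (n + 1) → ℝ) →ₗ[ℝ] (V n →L[ℝ] V n) :=
    ⟨⟨fun M ↦ mat.symm (Matrix.of M), fun S T ↦ map_add mat.symm (Matrix.of S) (Matrix.of T)⟩,
      fun c T ↦ map_smul mat.symm c (Matrix.of T)⟩
  exact (LinearMap.toContinuousLinearMap g).contDiff.comp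
    (contDiff_pi.2 fun i ↦ contDiff_pi.2 fun j ↦ hf i j)

/-- The unipotent endomorphism adding to each entry `A i j` above the diagonal the multiple
`c * dualDiag l i` of the entry `A j i` below the diagonal. For `c = 1`, it maps the Lie algebra of
`G_l` onto the strictly lower triangular matrices. -/
def shear (c : ℝ) (p : ℝ × (V n →L[ℝ] V n)) : V n →L[ℝ] V n :=
  mat.symm (Matrix.of fun i j ↦
    mat p.2 i j + c * (if i < j then dualDiag p.1 i * mat p.2 j i else 0))

lemma mat_shear (c : ℝ) (p : ℝ × (V n →L[ℝ] V n)) (i j : Fin (n + 1)) :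
    mat (shear c p) i j =
      mat p.2 i j + c * (if i < j then dualDiag p.1 i * mat p.2 j i else 0) := by
  rw [shear, StarAlgEquiv.apply_symm_apply, Matrix.of_apply]

lemma shear_shear (c d l l' : ℝ) (T : V n →L[ℝ] V n) (h : c = -d) (hl : l = l') :
    shear c (l, shear d (l', T)) = T := by
  subst h hl
  have : mat (shear (-d) (l, shear d (l, T))) = mat T := by
    ext i j
    simp only [mat_shear]
    split_ifs with h1 h2
    · exact absurd h2 (not_lt.2 h1.le)
    · ring
    · ring
  exact mat.injective this

lemma contDiff_shear (c : ℝ) : ContDiff ℝ ∞ (shear (n := n) c) := by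
  refine contDiff_mat_symm fun i j ↦ ?_
  have h1 : ∀ i j, ContDiff ℝ ∞ (fun p : ℝ × (V n →L[ℝ] V n) ↦ mat p.2 i j) := fun i j ↦
    (contDiff_mat_apply i j).comp contDiff_snd
  have h2 : ContDiff ℝ ∞ (fun p : ℝ × (V n →L[ℝ] V n) ↦ dualDiag (n := n) p.1 i) := by
    induction i using Fin.cases with
    | zero => exact contDiff_fst
    | succ i => exact contDiff_const
  split_ifs
  · exact (h1 i j).add (contDiff_const.mul (h2.mul (h1 j i)))
  · exact (h1 i j).add contDiff_const

lemma isInfinitesimal_iff_shear (T : V n →L[ℝ] V n) :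
    IsInfinitesimal l (mat T) ↔ ∀ i j, i ≤ j → mat (shear 1 (l, T)) i j = 0 := by
  simp only [mat_shear, one_mul]
  rfl

/-- The fibrewise linear diffeomorphism of `ℝ × End(ℝ^(n+1))` given by `shear`. -/
def shearHomeomorph (n : ℕ) : ℝ × (V n →L[ℝ] V n) ≃ₜ ℝ × (V n →L[ℝ] V n) where
  toFun p := (p.1, shear 1 p)
  invFun p := (p.1, shear (-1) p)
  left_inv p := Prod.ext rfl (shear_shear _ _ _ _ _ rfl rfl)
  right_inv p := Prod.ext rfl (shear_shear _ _ _ _ _ (by norm_num) rfl)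
  continuous_toFun := continuous_fst.prodMk (contDiff_shear 1).continuous
  continuous_invFun := continuous_fst.prodMk (contDiff_shear (-1)).continuous

/-! ### Connectedness and compactness -/

/-- A continuous function with values in `{1, -1}` is constant on connected sets. -/
lemma _root_.IsPreconnected.eq_one_of_eq_one_or_neg_one {X : Type*} [TopologicalSpace X] {s : Set X}
    (hs : IsPreconnected s) {f : X → ℝ} (hf : ContinuousOn f s)
    (h : ∀ x ∈ s, f x = 1 ∨ f x = -1) {x₀ : X} (hx₀ : x₀ ∈ s) (h0 : f x₀ = 1) {x : X}
    (hx : x ∈ s) : f x = 1 := by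
  by_contra hne
  have h1 := (h x hx).resolve_left hne
  have h2 := hs.intermediate_value hx hx₀ hf
  rw [h0, h1] at h2
  obtain ⟨y, hy, hy0⟩ := h2 (show (0 : ℝ) ∈ Set.Icc (-1) 1 by simp)
  rcases h y hy with h3 | h3 <;> rw [h3] at hy0 <;> norm_num at hy0

/-- The square matrices of size `n + 1`. -/
abbrev Mat (n : ℕ) : Type := Matrix (Fin (n + 1)) (Fin (n + 1)) ℝ

section Orthogonal

/-- The identification of orthogonal matrices with linear isometries. -/
def orthogonalEquiv (n : ℕ) :
    Matrix.orthogonalGroup (Fin (n + 1)) ℝ ≃* (V n ≃ₗᵢ[ℝ] V n) :=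
  (Unitary.mapEquiv
    { toFun := (mat (n := n)).symm
      invFun := mat
      left_inv := mat.apply_symm_apply
      right_inv := mat.symm_apply_apply
      map_mul' := map_mul _
      map_star' := map_star _ }).toMulEquiv.trans Unitary.linearIsometryEquiv

lemma orthogonalEquiv_apply (M : Matrix.orthogonalGroup (Fin (n + 1)) ℝ) (x : V n) :
    orthogonalEquiv n M x = (mat.symm (M : Mat n) : V n →L[ℝ] V n) x := rfl

lemma orthogonalEquiv_symm_apply (φ : V n ≃ₗᵢ[ℝ] V n) (i j : Fin (n + 1)) :
    ((orthogonalEquiv n).symm φ : Mat n) i j = φ (EuclideanSpace.single j 1) i := by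
  obtain ⟨M, rfl⟩ := (orthogonalEquiv n).surjective φ
  rw [MulEquiv.symm_apply_apply, orthogonalEquiv_apply, ← mat_apply, StarAlgEquiv.apply_symm_apply]

/-- The matrix of the reflection in the hyperplane orthogonal to `v`. -/
def reflMat (v : V n) : Matrix.orthogonalGroup (Fin (n + 1)) ℝ :=
  (orthogonalEquiv n).symm (ℝ ∙ v)ᗮ.reflection

lemma reflMat_apply (v : V n) (i j : Fin (n + 1)) :
    (reflMat v : Mat n) i j =
      (if i = j then 1 else 0) - 2 * (v j / ‖v‖ ^ 2) * v i := by
  rw [reflMat, orthogonalEquiv_symm_apply, Submodule.reflection_orthogonal_apply,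
    Submodule.reflection_singleton_apply]
  have : inner ℝ v (EuclideanSpace.single j 1) = v j := by
    simp [EuclideanSpace.inner_single_right]
  rw [this]
  simp [PiLp.single_apply]
  ring

lemma reflMat_mul_self (v : V n) : reflMat v * reflMat v = 1 := by
  rw [reflMat, ← map_mul, LinearIsometryEquiv.mul_def, Submodule.reflection_trans_reflection]
  exact map_one _

lemma det_reflMat {v : V n} (hv : v ≠ 0) : (reflMat v : Mat n).det = -1 := by
  have h1 := (ℝ ∙ v)ᗮ.det_reflection
  rw [Submodule.orthogonal_orthogonal, finrank_span_singleton hv, pow_one] at h1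
  rw [← h1, ← StarAlgEquiv.apply_symm_apply mat (reflMat v : Mat n), ← det_eq_det_mat]
  congr 1
  refine LinearMap.ext fun x ↦ (orthogonalEquiv_apply (reflMat v) x).symm.trans ?_
  rw [reflMat, MulEquiv.apply_symm_apply]
  rfl

lemma continuousOn_reflMat : ContinuousOn (reflMat (n := n)) {0}ᶜ := by
  rw [Topology.IsInducing.subtypeVal.continuousOn_iff]
  refine continuousOn_pi.2 fun i ↦ continuousOn_pi.2 fun j ↦ ?_
  simp only [Function.comp_apply, reflMat_apply]
  have h : ∀ x ∈ ({0}ᶜ : Set (V n)), ‖x‖ ^ 2 ≠ 0 := fun x hx ↦ by simpa using hx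
  fun_prop (disch := assumption)

lemma reflMat_zero : reflMat (0 : V n) = 1 := by
  ext i j
  rw [reflMat_apply]
  simp [Matrix.one_apply]

lemma det_eq_one_of_mem_connectedComponent {M : Matrix.orthogonalGroup (Fin (n + 1)) ℝ}
    (hM : M ∈ Subgroup.connectedComponentOfOne (Matrix.orthogonalGroup (Fin (n + 1)) ℝ)) :
    (M : Mat n).det = 1 := by
  refine isPreconnected_connectedComponent.eq_one_of_eq_one_or_neg_one
    (f := fun M : Matrix.orthogonalGroup (Fin (n + 1)) ℝ ↦ (M : Mat n).det)
    (Continuous.matrix_det continuous_subtype_val).continuousOn (fun M _ ↦ ?_)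
    mem_connectedComponent (x₀ := 1) (by simp) hM
  have := Matrix.det_of_mem_unitary M.2
  rw [← mul_self_eq_one_iff]
  simpa using (Unitary.mem_iff.1 this).1

/-- A product of reflections of determinant `1` lies in the identity component of the orthogonal
group: all reflections agree modulo this component, as the hyperplane of a reflection can be moved
continuously to any other hyperplane. -/
lemma mem_connectedComponent_of_det_eq_one (hn : 1 ≤ n)
    {M : Matrix.orthogonalGroup (Fin (n + 1)) ℝ} (hM : (M : Mat n).det = 1) :
    M ∈ Subgroup.connectedComponentOfOne (Matrix.orthogonalGroup (Fin (n + 1)) ℝ) := by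
  set N := Subgroup.connectedComponentOfOne (Matrix.orthogonalGroup (Fin (n + 1)) ℝ)
  have : N.Normal := ⟨fun a ha g ↦ by
    have hc : Continuous fun x : Matrix.orthogonalGroup (Fin (n + 1)) ℝ ↦ g * x * g⁻¹ := by fun_prop
    exact (isPreconnected_connectedComponent.image _ hc.continuousOn).subset_connectedComponent
      ⟨1, mem_connectedComponent, by simp⟩ ⟨a, ha, rfl⟩⟩
  set e : V n := EuclideanSpace.single 0 1
  have he : e ≠ 0 := by simp [e]
  have hrank : 1 < Module.rank ℝ (V n) := by
    rw [rank_eq_card_basis (EuclideanSpace.basisFun (Fin (n + 1)) ℝ).toBasis]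
    simp
    exact_mod_cast hn
  have hq : ∀ v : V n, v ≠ 0 → (reflMat v : _ ⧸ N) = reflMat e := by
    intro v hv
    rw [eq_comm, QuotientGroup.eq]
    have hc : ContinuousOn (fun v : V n ↦ (reflMat e)⁻¹ * reflMat v) {0}ᶜ :=
      continuousOn_const.mul continuousOn_reflMat
    have := (isConnected_compl_singleton_of_one_lt_rank hrank (0 : V n)).isPreconnected.image _ hc
    exact this.subset_connectedComponent ⟨e, he, inv_mul_cancel _⟩ ⟨v, hv, rfl⟩
  have hlist : ∀ L : List (V n), ∃ k : ℕ, ((orthogonalEquiv n).symm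
      (L.map fun v ↦ (ℝ ∙ v)ᗮ.reflection).prod : _ ⧸ N) = ((reflMat e) ^ k :) := by
    intro L
    induction L with
    | nil => exact ⟨0, by simp⟩
    | cons v L ih =>
      obtain ⟨k, hk⟩ := ih
      rw [List.map_cons, List.prod_cons, map_mul, QuotientGroup.mk_mul, hk]
      change ∃ k', (reflMat v : _ ⧸ N) * _ = _
      rcases eq_or_ne v 0 with rfl | hv
      · exact ⟨k, by rw [reflMat_zero, QuotientGroup.mk_one, one_mul]⟩
      · exact ⟨k + 1, by rw [hq v hv, ← QuotientGroup.mk_mul, pow_succ']⟩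
  obtain ⟨L, -, hL⟩ := (orthogonalEquiv n M).reflections_generate_dim
  obtain ⟨k, hk⟩ := hlist L
  rw [← hL, MulEquiv.symm_apply_apply, eq_comm, QuotientGroup.eq] at hk
  have hdet := det_eq_one_of_mem_connectedComponent hk
  rcases Nat.even_or_odd' k with ⟨j, rfl | rfl⟩
  · rwa [pow_mul, sq, reflMat_mul_self, one_pow, inv_one, one_mul] at hk
  · rw [pow_succ, pow_mul, sq, reflMat_mul_self, one_pow, one_mul,
      inv_eq_of_mul_eq_one_left (reflMat_mul_self e), Submonoid.coe_mul, Matrix.det_mul, hM,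
      det_reflMat he] at hdet
    norm_num at hdet

lemma isPreconnected_specialOrthogonalGroup (hn : 1 ≤ n) :
    IsPreconnected (Matrix.specialOrthogonalGroup (Fin (n + 1)) ℝ : Set (Mat n)) := by
  have : (Matrix.specialOrthogonalGroup (Fin (n + 1)) ℝ : Set (Mat n)) =
      Subtype.val '' (connectedComponent (1 : Matrix.orthogonalGroup (Fin (n + 1)) ℝ)) := by
    ext M
    rw [SetLike.mem_coe, Matrix.mem_specialOrthogonalGroup_iff]
    constructor
    · rintro ⟨h1, h2⟩
      exact ⟨⟨M, h1⟩, mem_connectedComponent_of_det_eq_one hn h2, rfl⟩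
    · rintro ⟨M, hM, rfl⟩
      exact ⟨M.2, det_eq_one_of_mem_connectedComponent hM⟩
  rw [this]
  exact isPreconnected_connectedComponent.image _ continuous_subtype_val.continuousOn

lemma isCompact_specialOrthogonalGroup (m : ℕ) :
    IsCompact (Matrix.specialOrthogonalGroup (Fin m) ℝ : Set (Matrix (Fin m) (Fin m) ℝ)) := by
  have hK : IsCompact (Set.univ.pi fun _ : Fin m ↦ Set.univ.pi fun _ : Fin m ↦
      Set.Icc (-1 : ℝ) 1) := isCompact_univ_pi fun _ ↦ isCompact_univ_pi fun _ ↦ isCompact_Icc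
  refine hK.of_isClosed_subset ?_ fun M hM i _ j _ ↦ ?_
  · have : (Matrix.specialOrthogonalGroup (Fin m) ℝ : Set (Matrix (Fin m) (Fin m) ℝ)) =
        {M | M * star M = 1} ∩ {M | M.det = 1} := by
      ext M
      rw [SetLike.mem_coe, Matrix.mem_specialOrthogonalGroup_iff, Matrix.mem_orthogonalGroup_iff]
      rfl
    rw [this]
    exact (isClosed_eq (by fun_prop) continuous_const).inter
      (isClosed_eq (Continuous.matrix_det continuous_id) continuous_const)
  · have hM' := Matrix.mem_specialOrthogonalGroup_iff.1 (SetLike.mem_coe.1 hM)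
    have := entry_norm_bound_of_unitary hM'.1 i j
    rwa [Real.norm_eq_abs, abs_le] at this

end Orthogonal

/-- Every element of `SO(η_l)` for `0 < l` is conjugate, by a fixed diagonal matrix, to
an element of `SO(n + 1)`. -/
lemma val_image_SOeta_of_pos (hl : 0 < l) :
    (Units.val : GLV n → V n →L[ℝ] V n) '' (SOeta n l) =
      (fun M : Mat n ↦ mat.symm (Matrix.diagonal (Fin.cons 1 fun _ ↦ (√l)⁻¹) * M *
        Matrix.diagonal (Fin.cons 1 fun _ ↦ √l))) ''
        (Matrix.specialOrthogonalGroup (Fin (n + 1)) ℝ : Set (Mat n)) := by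
  have hs : √l ≠ 0 := (Real.sqrt_pos.2 hl).ne'
  set P : Mat n := Matrix.diagonal (Fin.cons 1 fun _ ↦ √l) with hP
  set Q : Mat n := Matrix.diagonal (Fin.cons 1 fun _ ↦ (√l)⁻¹) with hQ
  have hPQ : P * Q = 1 := by
    rw [hP, hQ, Matrix.diagonal_mul_diagonal, ← Matrix.diagonal_one]
    congr 1; ext i
    induction i using Fin.cases <;> simp [hs]
  have hQP : Q * P = 1 := mul_eq_one_comm.1 hPQ
  have hJ : Matrix.diagonal (formDiag l) = P * P := by
    rw [hP, Matrix.diagonal_mul_diagonal]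
    congr 1; ext i
    induction i using Fin.cases <;> simp [hl.le]
  have hPt : P.transpose = P := Matrix.diagonal_transpose _
  have hQt : Q.transpose = Q := Matrix.diagonal_transpose _
  have hdet : ∀ M : Mat n, (Q * M * P).det = M.det := fun M ↦ by
    rw [Matrix.det_mul, Matrix.det_mul, mul_right_comm, ← Matrix.det_mul, hQP, Matrix.det_one,
      one_mul]
  have hdet' : ∀ M : Mat n, (P * M * Q).det = M.det := fun M ↦ by
    rw [Matrix.det_mul, Matrix.det_mul, mul_right_comm, ← Matrix.det_mul, hPQ, Matrix.det_one,
      one_mul]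
  have hcancel : ∀ M : Mat n, Q * (P * M * Q) * P = M := fun M ↦ by
    rw [mul_assoc, mul_assoc (P * M), hQP, mul_one, ← mul_assoc, hQP, one_mul]
  ext T
  constructor
  · rintro ⟨g, hg, rfl⟩
    rw [SetLike.mem_coe, mem_SOeta_iff hl.ne', PreservesForm, hJ] at hg
    refine ⟨P * mat (g : V n →L[ℝ] V n) * Q, ?_, ?_⟩
    · rw [SetLike.mem_coe, Matrix.mem_specialOrthogonalGroup_iff, hdet',
        Matrix.mem_orthogonalGroup_iff']
      refine ⟨?_, hg.2⟩
      rw [Matrix.transpose_mul, Matrix.transpose_mul, hPt, hQt]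
      calc _ = Q * ((mat (g : V n →L[ℝ] V n)).transpose * (P * P) * mat (g : V n →L[ℝ] V n)) *
            Q := by noncomm_ring
        _ = (Q * P) * (P * Q) := by rw [hg.1]; noncomm_ring
        _ = 1 := by rw [hPQ, hQP, one_mul]
    · simp only
      rw [hcancel, StarAlgEquiv.symm_apply_apply]
  · rintro ⟨M, hM, rfl⟩
    rw [SetLike.mem_coe, Matrix.mem_specialOrthogonalGroup_iff,
      Matrix.mem_orthogonalGroup_iff'] at hM
    have hu : IsUnit (Q * M * P) := by
      rw [Matrix.isUnit_iff_isUnit_det, hdet, hM.2]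
      exact isUnit_one
    refine ⟨(hu.map mat.symm).unit, ?_, rfl⟩
    rw [SetLike.mem_coe, mem_SOeta_iff hl.ne', IsUnit.unit_spec, StarAlgEquiv.apply_symm_apply,
      hdet]
    refine ⟨?_, hM.2⟩
    have h1 := hM.1
    rw [PreservesForm, hJ, Matrix.transpose_mul, Matrix.transpose_mul, hPt, hQt]
    calc _ = P * (M.transpose * ((Q * P) * (P * Q)) * M) * P := by noncomm_ring
      _ = P * P := by rw [hPQ, hQP, mul_one, mul_one, h1, mul_one]

lemma isPreconnected_SOeta_of_pos (hn : 1 ≤ n) (hl : 0 < l) :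
    IsPreconnected (SOeta n l : Set (GLV n)) := by
  rw [← Units.isOpenEmbedding_val.isInducing.isPreconnected_image, val_image_SOeta_of_pos hl]
  refine (isPreconnected_specialOrthogonalGroup hn).image _ (Continuous.continuousOn ?_)
  exact continuous_mat_symm.comp (by fun_prop)

lemma isCompact_SOeta_of_pos (hl : 0 < l) : IsCompact (SOeta n l : Set (GLV n)) := by
  rw [Units.isOpenEmbedding_val.isInducing.isCompact_iff, val_image_SOeta_of_pos hl]
  refine (isCompact_specialOrthogonalGroup (n + 1)).image ?_
  exact continuous_mat_symm.comp (by fun_prop)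

/-- The endomorphism with matrix `(1, 0; w, B)`. -/
def motion (w : Fin n → ℝ) (B : Matrix (Fin n) (Fin n) ℝ) : V n →L[ℝ] V n :=
  mat.symm (Matrix.of (Fin.cons (Fin.cons 1 0) fun i ↦ Fin.cons (w i) (B i)))

lemma motion_apply_zero (w : Fin n → ℝ) (B : Matrix (Fin n) (Fin n) ℝ) (x : V n) :
    motion w B x 0 = x 0 := by
  rw [motion, mat_symm_apply, Fin.sum_univ_succ]
  simp

lemma motion_apply_succ (w : Fin n → ℝ) (B : Matrix (Fin n) (Fin n) ℝ) (x : V n) (i : Fin n) :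
    motion w B x i.succ = x 0 * w i + ∑ j, B i j * x j.succ := by
  rw [motion, mat_symm_apply, Fin.sum_univ_succ]
  simp [mul_comm]

lemma continuous_motion :
    Continuous fun p : (Fin n → ℝ) × Matrix (Fin n) (Fin n) ℝ ↦ motion p.1 p.2 := by
  refine continuous_mat_symm.comp (continuous_pi fun i ↦ continuous_pi fun j ↦ ?_)
  induction i using Fin.cases with
  | zero => simp only [Matrix.of_apply, Fin.cons_zero]; exact continuous_const
  | succ i =>
    induction j using Fin.cases with
    | zero => simp only [Matrix.of_apply, Fin.cons_zero, Fin.cons_succ]; fun_prop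
    | succ j =>
      simp only [Matrix.of_apply, Fin.cons_succ]
      exact continuous_snd.matrix_elem i j

lemma isUnit_motion (w : Fin n → ℝ) {B : Matrix (Fin n) (Fin n) ℝ} (hB : B.det = 1) :
    IsUnit (motion w B) := by
  have : IsUnit (Matrix.of (Fin.cons (Fin.cons 1 0) fun i ↦ Fin.cons (w i) (B i)) : Mat n) := by
    rw [Matrix.isUnit_iff_isUnit_det, det_eq_det_submatrix (by simp) (by simp)]
    have e : (Matrix.of (Fin.cons (Fin.cons 1 0) fun i ↦ Fin.cons (w i) (B i)) :
        Mat n).submatrix Fin.succ Fin.succ = B := by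
      ext i j
      simp
    rw [e, hB]
    exact isUnit_one
  exact this.map mat.symm

lemma isPreconnected_euclideanGroup (hn : 2 ≤ n) :
    IsPreconnected (euclideanGroup n : Set (GLV n)) := by
  obtain ⟨k, rfl⟩ := Nat.exists_eq_add_of_le' (show 1 ≤ n by omega)
  rw [← Units.isOpenEmbedding_val.isInducing.isPreconnected_image]
  have : (Units.val : GLV (k + 1) → V (k + 1) →L[ℝ] V (k + 1)) '' (euclideanGroup (k + 1)) =
      (fun p : (Fin (k + 1) → ℝ) × Mat k ↦ motion p.1 p.2) ''
        (Set.univ ×ˢ (Matrix.specialOrthogonalGroup (Fin (k + 1)) ℝ : Set (Mat k))) := by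
    ext T
    constructor
    · rintro ⟨g, ⟨w, B, hB, h⟩, rfl⟩
      refine ⟨(w, B), ⟨trivial, hB⟩, ?_⟩
      ext x i
      induction i using Fin.cases with
      | zero => rw [motion_apply_zero, (h x).1]
      | succ i => rw [motion_apply_succ, (h x).2]
    · rintro ⟨⟨w, B⟩, ⟨-, hB⟩, rfl⟩
      refine ⟨(isUnit_motion w (Matrix.mem_specialOrthogonalGroup_iff.1 hB).2).unit, ?_, rfl⟩
      exact ⟨w, B, hB, fun x ↦ ⟨motion_apply_zero w B x, motion_apply_succ w B x⟩⟩
  rw [this]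
  exact (isPreconnected_univ.prod (isPreconnected_specialOrthogonalGroup (by omega))).image _
    continuous_motion.continuousOn

lemma isPreconnected_G (hn : 2 ≤ n) (l : ℝ) : IsPreconnected (G n l : Set (GLV n)) := by
  rcases lt_trichotomy l 0 with hl | rfl | hl
  · rw [G_of_neg hl]
    exact isPreconnected_connectedComponent.image _ continuous_subtype_val.continuousOn
  · rw [G_zero]; exact isPreconnected_euclideanGroup hn
  · rw [G_of_pos hl]; exact isPreconnected_SOeta_of_pos (by omega) hl

/-! ### Smooth sections of the bundle -/

/-- The values at `l₀` of the smooth sections of the bundle of the groups `G_l`. -/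
def sectionValues (n : ℕ) (l₀ : ℝ) : Subgroup (GLV n) where
  carrier := {g | ∃ σ : ℝ → GLV n, ContMDiff 𝓘(ℝ, ℝ) 𝓘(ℝ, V n →L[ℝ] V n) ∞ σ ∧
    (∀ l, σ l ∈ G n l) ∧ σ l₀ = g}
  one_mem' := ⟨fun _ ↦ 1, contMDiff_const, fun _ ↦ one_mem _, rfl⟩
  mul_mem' := by
    rintro _ _ ⟨σ, h1, h2, rfl⟩ ⟨τ, h3, h4, rfl⟩
    exact ⟨fun l ↦ σ l * τ l, h1.mul h3, fun l ↦ mul_mem (h2 l) (h4 l), rfl⟩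
  inv_mem' := by
    rintro _ ⟨σ, h1, h2, rfl⟩
    exact ⟨fun l ↦ (σ l)⁻¹, h1.inv, fun l ↦ inv_mem (h2 l), rfl⟩

/-- The Cayley transform of a small element `T` of the Lie algebra of `G_l₀` extends to a section:
move `T` through the Lie algebras of the groups `G_l`, keeping the entries below the diagonal, and
cut it off away from `l₀` in order to stay in the unit ball. -/
lemma cayleyUnit_mem_sectionValues {l₀ : ℝ} {T : V n →L[ℝ] V n} (hT : ‖T‖ < 1)
    (h : IsInfinitesimal l₀ (mat T)) : cayleyUnit T ∈ sectionValues n l₀ := by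
  set A : ℝ → V n →L[ℝ] V n := fun l ↦ shear (-1) (l, shear 1 (l₀, T)) with hA
  have hA0 : A l₀ = T := shear_shear _ _ _ _ _ rfl rfl
  have hAc : ContDiff ℝ ∞ A := (contDiff_shear (-1)).comp (contDiff_id.prodMk contDiff_const)
  have hAi : ∀ l, IsInfinitesimal l (mat (A l)) := fun l ↦ by
    rw [isInfinitesimal_iff_shear, hA, shear_shear _ _ _ _ _ (by norm_num) rfl,
      ← isInfinitesimal_iff_shear]
    exact h
  have hnear : ∀ᶠ l in nhds l₀, ‖A l‖ < 1 := by
    refine (hAc.continuous.norm.tendsto l₀).eventually_lt_const ?_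
    rwa [hA0]
  obtain ⟨δ, hδ, hball⟩ := Metric.eventually_nhds_iff_ball.1 hnear
  let χ : ContDiffBump l₀ := ⟨δ / 2, δ, half_pos hδ, half_lt_self hδ⟩
  have hlt : ∀ l, ‖χ l • A l‖ < 1 := fun l ↦ by
    by_cases hl : l ∈ Metric.ball l₀ δ
    · rw [norm_smul, Real.norm_of_nonneg χ.nonneg]
      exact (mul_le_of_le_one_left (norm_nonneg _) χ.le_one).trans_lt (hball l hl)
    · have h0 : χ l • A l = 0 := by
        rw [χ.zero_of_le_dist (not_lt.1 hl)]
        exact zero_smul ℝ (A l)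
      rw [h0, norm_zero]
      exact one_pos
  refine ⟨fun l ↦ cayleyUnit (χ l • A l), fun l ↦ ?_, fun l ↦ ?_, ?_⟩
  · have h1 : ContDiff ℝ ∞ fun l ↦ χ l • A l := χ.contDiff.smul hAc
    exact (contMDiffOn_cayleyChart_symm.contMDiffAt
      (cayleyChart.open_target.mem_nhds (hlt l))).comp l h1.contMDiff.contMDiffAt
  · refine cayleyUnit_mem_G (hlt l) ?_
    rw [map_smul]
    exact (hAi l).smul _
  · simp only
    rw [hA0, χ.one_of_mem_closedBall (Metric.mem_closedBall_self (half_pos hδ).le), one_smul]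

/-- There is a smooth section through every point, as the values of sections form an open subgroup
of a connected group. -/
lemma G_le_sectionValues (hn : 2 ≤ n) (l₀ : ℝ) : G n l₀ ≤ sectionValues n l₀ := by
  have : PreconnectedSpace (G n l₀) :=
    isPreconnected_iff_preconnectedSpace.1 (isPreconnected_G hn l₀)
  have hopen : IsOpen ((sectionValues n l₀).subgroupOf (G n l₀) : Set (G n l₀)) := by
    refine Subgroup.isOpen_of_mem_nhds _ (g := 1) ?_
    have h1 : (Subtype.val : G n l₀ → GLV n) ⁻¹' (cayleyChart).source ∈ nhds 1 :=
      continuous_subtype_val.continuousAt.preimage_mem_nhds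
        (cayleyChart.open_source.mem_nhds one_mem_cayleyChart_source)
    filter_upwards [h1] with g hg
    rw [SetLike.mem_coe, Subgroup.mem_subgroupOf, ← cayleyChart.left_inv hg]
    exact cayleyUnit_mem_sectionValues hg.2 (isInfinitesimal_cayleyInv g.2 hg.1)
  have htop := IsClopen.eq_univ ⟨Subgroup.isClosed_of_isOpen _ hopen, hopen⟩ ⟨1, one_mem _⟩
  intro g hg
  have : (⟨g, hg⟩ : G n l₀) ∈ ((sectionValues n l₀).subgroupOf (G n l₀) : Set (G n l₀)) := by
    rw [htop]; trivial
  exact this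

/-! ### The total space as a submanifold -/

/-- Left translation by the inverse of a continuous section, as a homeomorphism of `ℝ × GL`. -/
def translation (σ : ℝ → GLV n) (hσ : Continuous σ) : ℝ × GLV n ≃ₜ ℝ × GLV n where
  toFun p := (p.1, (σ p.1)⁻¹ * p.2)
  invFun p := (p.1, σ p.1 * p.2)
  left_inv p := by simp
  right_inv p := by simp
  continuous_toFun := by fun_prop
  continuous_invFun := by fun_prop

/-- The chart of `ℝ × GL(n+1)` obtained from a section `σ`: translate by `σ`, apply the Cayley
transform, and straighten the bundle of Lie algebras. -/
def ambientChart (σ : ℝ → GLV n) (hσ : Continuous σ) :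
    OpenPartialHomeomorph (ℝ × GLV n) (ModelProd ℝ (V n →L[ℝ] V n)) :=
  (translation σ hσ).toOpenPartialHomeomorph ≫ₕ
    ((OpenPartialHomeomorph.refl ℝ).prod cayleyChart ≫ₕ
      (shearHomeomorph n).toOpenPartialHomeomorph)

lemma mem_ambientChart_source {σ : ℝ → GLV n} {hσ : Continuous σ} {p : ℝ × GLV n} :
    p ∈ (ambientChart σ hσ).source ↔
      ((σ p.1)⁻¹ * p.2 : GLV n) ∈ (cayleyChart (R := V n →L[ℝ] V n)).source := by
  simp [ambientChart, translation]

lemma mem_ambientChart_target {σ : ℝ → GLV n} {hσ : Continuous σ} {p : ℝ × (V n →L[ℝ] V n)} :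
    p ∈ (ambientChart σ hσ).target ↔ ‖shear (-1) p‖ < 1 := by
  have : p ∈ (ambientChart σ hσ).target ↔
      shear (-1) p ∈ (cayleyChart (R := V n →L[ℝ] V n)).target := by
    simp [ambientChart, shearHomeomorph]
  exact this

lemma contMDiffOn_ambientChart {σ : ℝ → GLV n}
    (hσ : ContMDiff 𝓘(ℝ, ℝ) 𝓘(ℝ, V n →L[ℝ] V n) ∞ σ) :
    ContMDiffOn (𝓘(ℝ, ℝ).prod 𝓘(ℝ, V n →L[ℝ] V n)) 𝓘(ℝ, ℝ × (V n →L[ℝ] V n)) ∞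
      (fun p : ℝ × GLV n ↦
        (p.1, shear 1 (p.1, cayleyInv (((σ p.1)⁻¹ * p.2 : GLV n) : V n →L[ℝ] V n))))
      (ambientChart σ hσ.continuous).source := by
  have h1 : ContMDiff (𝓘(ℝ, ℝ).prod 𝓘(ℝ, V n →L[ℝ] V n)) 𝓘(ℝ, V n →L[ℝ] V n) ∞
      (fun p : ℝ × GLV n ↦ (σ p.1)⁻¹ * p.2) :=
    (hσ.comp contMDiff_fst).inv.mul contMDiff_snd
  have h2 := contMDiffOn_cayleyChart.comp (h1.contMDiffOn
    (s := (ambientChart σ hσ.continuous).source)) (fun p hp ↦ mem_ambientChart_source.1 hp)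
  have h3 := (contMDiff_fst (I := 𝓘(ℝ, ℝ)) (J := 𝓘(ℝ, V n →L[ℝ] V n)) (M := ℝ)
    (N := GLV n) (n := ∞)).contMDiffOn.prodMk_space h2
  have h4 : ContDiff ℝ ∞ fun p : ℝ × (V n →L[ℝ] V n) ↦ (p.1, shear 1 p) :=
    contDiff_fst.prodMk (contDiff_shear 1)
  exact h4.contMDiff.comp_contMDiffOn h3

lemma contMDiffOn_ambientChart_symm {σ : ℝ → GLV n}
    (hσ : ContMDiff 𝓘(ℝ, ℝ) 𝓘(ℝ, V n →L[ℝ] V n) ∞ σ) :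
    ContMDiffOn 𝓘(ℝ, ℝ × (V n →L[ℝ] V n)) (𝓘(ℝ, ℝ).prod 𝓘(ℝ, V n →L[ℝ] V n)) ∞
      (fun p : ℝ × (V n →L[ℝ] V n) ↦ (p.1, σ p.1 * cayleyUnit (shear (-1) p)))
      (ambientChart σ hσ.continuous).target := by
  have h0 : ContMDiff 𝓘(ℝ, ℝ × (V n →L[ℝ] V n)) 𝓘(ℝ, ℝ) ∞ (Prod.fst : ℝ × (V n →L[ℝ] V n) → ℝ) :=
    contDiff_fst.contMDiff
  have h1 : ContMDiffOn 𝓘(ℝ, ℝ × (V n →L[ℝ] V n)) 𝓘(ℝ, V n →L[ℝ] V n) ∞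
      (fun p : ℝ × (V n →L[ℝ] V n) ↦ cayleyUnit (shear (-1) p))
      (ambientChart σ hσ.continuous).target := fun p hp ↦
    ((contMDiffOn_cayleyChart_symm.contMDiffAt (cayleyChart.open_target.mem_nhds
      (mem_ambientChart_target.1 hp))).comp p
        (contDiff_shear (-1)).contMDiff.contMDiffAt).contMDiffWithinAt
  exact h0.contMDiffOn.prodMk ((hσ.comp h0).contMDiffOn.mul h1)

lemma ambientChart_mem_maximalAtlas {σ : ℝ → GLV n}
    (hσ : ContMDiff 𝓘(ℝ, ℝ) 𝓘(ℝ, V n →L[ℝ] V n) ∞ σ) :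
    ambientChart σ hσ.continuous ∈
      IsManifold.maximalAtlas (𝓘(ℝ, ℝ).prod 𝓘(ℝ, V n →L[ℝ] V n)) ∞ (ℝ × GLV n) := by
  refine OpenPartialHomeomorph.mem_maximalAtlas_of_contMDiffOn _ ?_ ?_
  · have := contMDiffOn_ambientChart hσ
    rw [modelWithCornersSelf_prod] at this
    exact this
  · have := contMDiffOn_ambientChart_symm hσ
    rw [modelWithCornersSelf_prod] at this
    exact this

/-! ### Coordinates -/

/-- The index set of the entries below the diagonal. -/
abbrev Below (n : ℕ) : Type := {p : Fin (n + 1) × Fin (n + 1) // p.2 < p.1}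

/-- The index set of the entries on or above the diagonal. -/
abbrev Above (n : ℕ) : Type := {p : Fin (n + 1) × Fin (n + 1) // p.1 ≤ p.2}

lemma card_below (n : ℕ) : Fintype.card (Below n) = n * (n + 1) / 2 := by
  let e : Below n ≃ (Σ i : Fin (n + 1), Fin i) :=
    { toFun := fun p ↦ ⟨p.1.1, ⟨p.1.2, p.2⟩⟩
      invFun := fun q ↦ ⟨(q.1, ⟨q.2, q.2.2.trans q.1.2⟩), q.2.2⟩
      left_inv := fun p ↦ rfl
      right_inv := fun q ↦ rfl }
  rw [Fintype.card_congr e, Fintype.card_sigma]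
  simp only [Fintype.card_fin]
  rw [Fin.sum_univ_eq_sum_range (fun i ↦ i) (n + 1), Finset.sum_range_id, Nat.add_sub_cancel,
    mul_comm]

/-- Decomposition of `ℝ × End(ℝ^(n+1))` by the entries below the diagonal and the others. -/
def splitEquiv (n : ℕ) :
    (ℝ × (V n →L[ℝ] V n)) ≃ₗ[ℝ] (ℝ × (Below n → ℝ)) × (Above n → ℝ) where
  toFun p := ((p.1, fun q ↦ mat p.2 q.1.1 q.1.2), fun q ↦ mat p.2 q.1.1 q.1.2)
  invFun z := (z.1.1, mat.symm (Matrix.of fun i j ↦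
    if h : j < i then z.1.2 ⟨(i, j), h⟩ else z.2 ⟨(i, j), not_lt.1 h⟩))
  map_add' p q := by
    simp only [Prod.fst_add, Prod.snd_add, map_add, Matrix.add_apply]
    rfl
  map_smul' c p := by
    simp only [Prod.smul_fst, Prod.smul_snd, map_smul, Matrix.smul_apply]
    rfl
  left_inv p := by
    refine Prod.ext rfl ?_
    simp only
    rw [StarAlgEquiv.symm_apply_eq]
    ext i j
    simp
  right_inv z := by
    refine Prod.ext (Prod.ext rfl ?_) ?_
    · ext ⟨⟨i, j⟩, h⟩
      simp only [StarAlgEquiv.apply_symm_apply, Matrix.of_apply]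
      rw [dif_pos h]
    · ext ⟨⟨i, j⟩, h⟩
      simp only [StarAlgEquiv.apply_symm_apply, Matrix.of_apply]
      rw [dif_neg (not_lt.2 h)]

/-- The identification of the model space of the total space with `ℝ × ℝ^(n(n+1)/2)`. -/
def baseEquiv (n : ℕ) :
    EuclideanSpace ℝ (Fin (1 + n * (n + 1) / 2)) ≃L[ℝ] ℝ × (Below n → ℝ) :=
  ContinuousLinearEquiv.ofFinrankEq (by
    rw [finrank_euclideanSpace_fin, Module.finrank_prod, Module.finrank_self,
      Module.finrank_fintype_fun_eq_card, card_below])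

/-- The identification of the model space of `ℝ × GL(n+1)` adapted to the slice charts. -/
def sliceEquiv (n : ℕ) :
    (EuclideanSpace ℝ (Fin (1 + n * (n + 1) / 2)) × (Above n → ℝ)) ≃L[ℝ]
      ℝ × (V n →L[ℝ] V n) :=
  ((baseEquiv n).prodCongr (ContinuousLinearEquiv.refl ℝ _)).trans
    (splitEquiv n).symm.toContinuousLinearEquiv

lemma sliceEquiv_symm_snd (p : ℝ × (V n →L[ℝ] V n)) (q : Above n) :
    ((sliceEquiv n).symm p).2 q = mat p.2 q.1.1 q.1.2 := rfl

lemma baseEquiv_sliceEquiv_symm_fst (p : ℝ × (V n →L[ℝ] V n)) :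
    (baseEquiv n ((sliceEquiv n).symm p).1).1 = p.1 := by
  change (baseEquiv n ((baseEquiv n).symm (splitEquiv n p).1)).1 = _
  rw [ContinuousLinearEquiv.apply_symm_apply]
  rfl

/-- In an ambient chart given by a section of the bundle, the total space is where the entries on
and above the diagonal vanish. -/
lemma isSliceChart_ambientChart {σ : ℝ → GLV n} {hσ : Continuous σ} (hG : ∀ l, σ l ∈ G n l) :
    IsSliceChart (𝓘(ℝ, ℝ).prod 𝓘(ℝ, V n →L[ℝ] V n)) (sliceEquiv n)
      (fun p : ℝ × GLV n ↦ p.2 ∈ G n p.1) (ambientChart σ hσ) := by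
  rintro ⟨l, g⟩ hp
  have hs := mem_ambientChart_source.1 hp
  set h : GLV n := (σ l)⁻¹ * g with hh
  have e1 : g ∈ G n l ↔ h ∈ G n l := (Subgroup.mul_mem_cancel_left _ (inv_mem (hG l))).symm
  have e2 : h ∈ G n l ↔ IsInfinitesimal l (mat (cayleyInv (h : V n →L[ℝ] V n))) := by
    refine ⟨fun hg ↦ isInfinitesimal_cayleyInv hg hs.1, fun hi ↦ ?_⟩
    have := cayleyUnit_mem_G hs.2 hi
    rwa [← cayleyChart_apply, ← cayleyChart_symm_apply, cayleyChart.left_inv hs] at this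
  change g ∈ G n l ↔ ((sliceEquiv n).symm
    (l, shear 1 (l, cayleyInv (h : V n →L[ℝ] V n)))).2 = 0
  rw [e1, e2, isInfinitesimal_iff_shear, funext_iff]
  simp only [sliceEquiv_symm_snd, Subtype.forall, Prod.forall]
  rfl

/-- The slice charts of `ℝ × GL(n+1)` along the total space of the bundle. -/
def totalAtlas (hn : 2 ≤ n) : SliceAtlas (𝓘(ℝ, ℝ).prod 𝓘(ℝ, V n →L[ℝ] V n)) (sliceEquiv n)
    (fun p : ℝ × GLV n ↦ p.2 ∈ G n p.1) where
  chart s := ambientChart (G_le_sectionValues hn _ s.2).choose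
    (G_le_sectionValues hn _ s.2).choose_spec.1.continuous
  mem_source s := by
    rw [mem_ambientChart_source, (G_le_sectionValues hn _ s.2).choose_spec.2.2, inv_mul_cancel]
    exact one_mem_cayleyChart_source
  isSliceChart s := isSliceChart_ambientChart (G_le_sectionValues hn _ s.2).choose_spec.2.1
  mem_maximalAtlas s := ambientChart_mem_maximalAtlas (G_le_sectionValues hn _ s.2).choose_spec.1

/-! ### The bundle of Lie groups -/

/-- The smooth structure of the total space as a submanifold of `ℝ × GL(n+1)`. -/
@[reducible] def totalChartedSpace (hn : 2 ≤ n) :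
    ChartedSpace (EuclideanSpace ℝ (Fin (1 + n * (n + 1) / 2))) (Total n) :=
  (totalAtlas hn).chartedSpace

lemma isImmersionOfComplement_total (hn : 2 ≤ n) :
    letI := totalChartedSpace hn
    IsImmersionOfComplement (Above n → ℝ) (𝓡 (1 + n * (n + 1) / 2))
      (𝓘(ℝ, ℝ).prod 𝓘(ℝ, V n →L[ℝ] V n)) ∞ (Subtype.val : Total n → ℝ × GLV n) :=
  (totalAtlas hn).isImmersionOfComplement_val

/-- In the charts of the total space, the projection to `ℝ` is the projection to the first
component of `ℝ × ℝ^(n(n+1)/2)`. -/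
lemma isSubmersion_fst (hn : 2 ≤ n) :
    letI := totalChartedSpace hn
    IsSubmersion (𝓡 (1 + n * (n + 1) / 2)) 𝓘(ℝ, ℝ) ∞ (fun g : Total n ↦ g.1.1) := by
  let := totalChartedSpace hn
  refine IsSubmersionOfComplement.isSubmersion (F := Below n → ℝ) fun s ↦ ?_
  refine IsSubmersionAtOfComplement.mk_of_charts (baseEquiv n) _ (chartAt ℝ s.1.1)
    ((totalAtlas hn).mem_source s) (by simp) ((totalAtlas hn).sliceChart_mem_maximalAtlas s)
    (IsManifold.chart_mem_maximalAtlas _) (fun _ _ ↦ by rw [chartAt_self_eq]; trivial) ?_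
  intro u hu
  have hu1 : u ∈ (sliceChart (sliceEquiv n) ((totalAtlas hn).chart s)
      ((totalAtlas hn).isSliceChart s) s).target := by
    simpa [OpenPartialHomeomorph.extend] using hu
  set c := sliceChart (sliceEquiv n) ((totalAtlas hn).chart s)
      ((totalAtlas hn).isSliceChart s) s with hc
  have e : (baseEquiv n (c (c.symm u))).1 = (c.symm u).1.1 :=
    baseEquiv_sliceEquiv_symm_fst _
  rw [c.right_inv hu1] at e
  exact e.symm

/-- The fibrewise multiplication is smooth on the fibre product. -/
lemma contMDiffOn_total_mul (hn : 2 ≤ n) {f : Total n × Total n → Total n}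
    {s : Set (Total n × Total n)} (hf : ∀ p ∈ s, (f p).1 = (p.1.1.1, p.1.1.2 * p.2.1.2)) :
    letI := totalChartedSpace hn
    ContMDiffOn ((𝓡 (1 + n * (n + 1) / 2)).prod (𝓡 (1 + n * (n + 1) / 2)))
      (𝓡 (1 + n * (n + 1) / 2)) ∞ f s := by
  let := totalChartedSpace hn
  have hval := (isImmersionOfComplement_total hn).contMDiff
  have h1 : ContMDiff ((𝓡 (1 + n * (n + 1) / 2)).prod (𝓡 (1 + n * (n + 1) / 2)))
      (𝓘(ℝ, ℝ).prod 𝓘(ℝ, V n →L[ℝ] V n)) ∞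
      (fun p : Total n × Total n ↦ ((p.1.1.1, p.1.1.2 * p.2.1.2) : ℝ × GLV n)) := by
    have h2 := hval.comp (contMDiff_fst (I := 𝓡 (1 + n * (n + 1) / 2))
      (J := 𝓡 (1 + n * (n + 1) / 2)) (M := Total n) (N := Total n))
    have h3 := hval.comp (contMDiff_snd (I := 𝓡 (1 + n * (n + 1) / 2))
      (J := 𝓡 (1 + n * (n + 1) / 2)) (M := Total n) (N := Total n))
    exact (contMDiff_fst.comp h2).prodMk ((contMDiff_snd.comp h2).mul (contMDiff_snd.comp h3))
  have h4 := h1.contMDiffOn.congr (s := s) (f₁ := Subtype.val ∘ f) hf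
  intro p hp
  refine ContMDiffWithinAt.of_comp_isImmersionAtOfComplement
    (isImmersionOfComplement_total hn (f p)) ?_ (h4 p hp)
  exact (Topology.IsInducing.subtypeVal.continuousWithinAt_iff).2 (h4 p hp).continuousWithinAt

/-- A map to the total space is smooth if it is smooth as a map to `ℝ × GL(n+1)`. -/
lemma contMDiff_total_of_val (hn : 2 ≤ n) {E H M : Type*} [NormedAddCommGroup E] [NormedSpace ℝ E]
    [TopologicalSpace H] {I : ModelWithCorners ℝ E H} [TopologicalSpace M] [ChartedSpace H M]
    {f : M → Total n} (h : ContMDiff I (𝓘(ℝ, ℝ).prod 𝓘(ℝ, V n →L[ℝ] V n)) ∞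
      (fun x ↦ ((f x).1 : ℝ × GLV n))) :
    letI := totalChartedSpace hn
    ContMDiff I (𝓡 (1 + n * (n + 1) / 2)) ∞ f := by
  let := totalChartedSpace hn
  rw [ContMDiff.iff_comp_isImmersionOfComplement (isImmersionOfComplement_total hn)]
  exact ⟨Topology.IsInducing.subtypeVal.continuous_iff.2 h.continuous, h⟩

/-- The bundle of the Lie groups `G_l` over `ℝ`. -/
def lieGroupBundle (hn : 2 ≤ n) :
    letI := totalChartedSpace hn
    letI : IsManifold (𝓡 (1 + n * (n + 1) / 2)) ∞ (Total n) := (totalAtlas hn).isManifold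
    LieGroupoid 𝓘(ℝ, ℝ) (𝓡 (1 + n * (n + 1) / 2)) ℝ (Total n) :=
  letI := totalChartedSpace hn
  letI : IsManifold (𝓡 (1 + n * (n + 1) / 2)) ∞ (Total n) := (totalAtlas hn).isManifold
  { source := fun g ↦ g.1.1
    target := fun g ↦ g.1.1
    comp := fun g h e ↦ ⟨(g.1.1, g.1.2 * h.1.2), mul_mem g.2 (by
      have := h.2
      change g.1.1 = h.1.1 at e
      rwa [← e] at this)⟩
    inv := fun g ↦ ⟨(g.1.1, g.1.2⁻¹), inv_mem g.2⟩
    unit := fun l ↦ ⟨(l, 1), one_mem _⟩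
    source_comp := fun _ _ e ↦ e
    target_comp := fun _ _ _ ↦ rfl
    comp_assoc := fun _ _ _ _ _ ↦ Subtype.ext (Prod.ext rfl (mul_assoc _ _ _))
    source_unit := fun _ ↦ rfl
    target_unit := fun _ ↦ rfl
    unit_comp := fun _ ↦ Subtype.ext (Prod.ext rfl (one_mul _))
    comp_unit := fun _ ↦ Subtype.ext (Prod.ext rfl (mul_one _))
    source_inv := fun _ ↦ rfl
    target_inv := fun _ ↦ rfl
    inv_comp := fun _ ↦ Subtype.ext (Prod.ext rfl (inv_mul_cancel _))
    comp_inv := fun _ ↦ Subtype.ext (Prod.ext rfl (mul_inv_cancel _))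
    isSubmersion_source := isSubmersion_fst hn
    isSubmersion_target := isSubmersion_fst hn
    contMDiffOn_comp := contMDiffOn_total_mul hn fun p hp ↦ by
      have hp' : p.1.1.1 = p.2.1.1 := hp
      rw [dif_pos hp']
    contMDiff_inv := by
      apply contMDiff_total_of_val hn
      have hval := (isImmersionOfComplement_total hn).contMDiff
      exact (contMDiff_fst.comp hval).prodMk (contMDiff_snd.comp hval).inv
    contMDiff_unit := by
      apply contMDiff_total_of_val hn
      exact contMDiff_id.prodMk contMDiff_const }

/-! ### Failure of local triviality -/

/-- The fibres over `0 < l` are compact, but the fibre over `0` is not, as it contains all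
translations. -/
lemma not_exists_homeomorph (hn : 2 ≤ n) {U : Set ℝ} (hU : IsOpen U) (h0 : (0 : ℝ) ∈ U)
    (Φ : ((fun g : Total n ↦ g.1.1) ⁻¹' U) ≃ₜ U × ((fun g : Total n ↦ g.1.1) ⁻¹' {0}))
    (hΦ : ∀ g, ((Φ g).1 : ℝ) = g.1.1.1) : False := by
  obtain ⟨δ, hδ, hball⟩ := Metric.isOpen_iff.1 hU 0 h0
  have hl : 0 < δ / 2 := half_pos hδ
  set l := δ / 2
  have hlU : l ∈ U := hball (by
    rw [Metric.mem_ball, Real.dist_0_eq_abs, abs_of_pos hl]; exact half_lt_self hδ)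
  have hG : G n l = SOeta n l := G_of_pos hl
  have hK : CompactSpace (SOeta n l) := isCompact_iff_compactSpace.1 (isCompact_SOeta_of_pos hl)
  let j : SOeta n l → ((fun g : Total n ↦ g.1.1) ⁻¹' U) := fun g ↦
    ⟨⟨(l, g), by rw [hG]; exact g.2⟩, hlU⟩
  have hj : Continuous j := by fun_prop
  let f : SOeta n l → ℝ := fun g ↦
    ((Φ (j g)).2.1.1.2 : V n →L[ℝ] V n) (EuclideanSpace.single 0 1) (Fin.succ ⟨0, by omega⟩)
  have hf : Continuous f := by
    have h1 : Continuous fun g ↦ ((Φ (j g)).2.1.1.2 : GLV n) := by fun_prop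
    have h2 : Continuous fun g ↦ ((Φ (j g)).2.1.1.2 : V n →L[ℝ] V n) :=
      Units.continuous_val.comp h1
    fun_prop
  obtain ⟨C, hC⟩ := (isCompact_range hf).bddAbove
  -- the translation by `(C + 1, 0, …, 0)` in the fibre over `0`
  let B : Matrix (Fin n) (Fin n) ℝ := 1
  let w : Fin n → ℝ := Pi.single ⟨0, by omega⟩ (C + 1)
  have hu : IsUnit (motion w B) := isUnit_motion w Matrix.det_one
  have hmem : hu.unit ∈ G n 0 := by
    rw [G_zero]
    exact ⟨w, B, one_mem _, fun x ↦ ⟨motion_apply_zero w B x, motion_apply_succ w B x⟩⟩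
  let t : ((fun g : Total n ↦ g.1.1) ⁻¹' {0}) := ⟨⟨(0, hu.unit), hmem⟩, rfl⟩
  have hy : (Φ.symm (⟨l, hlU⟩, t)).1.1.1 = l := by
    rw [← hΦ, Homeomorph.apply_symm_apply]
  have hy2 : (Φ.symm (⟨l, hlU⟩, t)).1.1.2 ∈ SOeta n l := by
    have := (Φ.symm (⟨l, hlU⟩, t)).1.2
    rwa [hy, hG] at this
  have hjy : j ⟨_, hy2⟩ = Φ.symm (⟨l, hlU⟩, t) :=
    Subtype.ext (Subtype.ext (Prod.ext hy.symm rfl))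
  have hval : f ⟨_, hy2⟩ = C + 1 := by
    simp only [f]
    rw [hjy, Homeomorph.apply_symm_apply]
    change motion w B (EuclideanSpace.single 0 1) (Fin.succ ⟨0, _⟩) = C + 1
    rw [motion_apply_succ]
    simp [w]
  have := hC ⟨_, hval⟩
  linarith

/-! ### Isometries of the model are linear -/

/-- The form `x₀ y₀ + l (x₁ y₁ + ⋯ + xₙ yₙ)` as a linear functional of its first argument. -/
def formLeft (l : ℝ) (y : V n) : V n →ₗ[ℝ] ℝ where
  toFun x := form l x y
  map_add' x x' := by
    simp only [form, PiLp.add_apply, add_mul, Finset.sum_add_distrib]; ring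
  map_smul' c x := by
    simp only [form, PiLp.smul_apply, smul_eq_mul, RingHom.id_apply, mul_assoc, ← Finset.mul_sum]
    ring

lemma formLeft_apply (x y : V n) : formLeft l y x = form l x y := rfl

lemma form_comm (x y : V n) : form l x y = form l y x := by
  simp only [form, mul_comm]

lemma form_sub_sub (x y : V n) :
    form l (x - y) (x - y) = form l x x - 2 * form l x y + form l y y := by
  have h1 := map_sub (formLeft l (x - y)) x y
  have h2 := map_sub (formLeft l x) x y
  have h3 := map_sub (formLeft l y) x y
  simp only [formLeft_apply] at h1 h2 h3
  rw [h1, form_comm x, form_comm y, h2, h3, form_comm y x]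
  ring

lemma form_self (x : V n) : form l x x = x 0 ^ 2 + l * ∑ i : Fin n, x i.succ ^ 2 := by
  simp only [form, sq]

lemma form_self_model (x : Model n l) : form l x.1 x.1 = 1 := by
  rw [form_self]; exact x.2.1

lemma form_le_one (hl : 0 < l) (x y : Model n l) : form l x.1 y.1 ≤ 1 := by
  have h := form_sub_sub (l := l) x.1 y.1
  rw [form_self_model, form_self_model, form_self] at h
  have : 0 ≤ (x.1 - y.1) 0 ^ 2 + l * ∑ i : Fin n, (x.1 - y.1) i.succ ^ 2 := by positivity
  linarith

lemma neg_one_le_form (hl : 0 < l) (x y : Model n l) : -1 ≤ form l x.1 y.1 := by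
  have h1 : form l (-y.1) (-y.1) = 1 := by
    rw [form_self]
    simp only [PiLp.neg_apply, neg_sq]
    exact y.2.1
  have h2 : form l x.1 (-y.1) = -form l x.1 y.1 := by
    rw [form_comm, ← formLeft_apply, map_neg, formLeft_apply, form_comm]
  have h := form_sub_sub (l := l) x.1 (-y.1)
  rw [form_self_model, h1, h2, form_self] at h
  have : 0 ≤ (x.1 - -y.1) 0 ^ 2 + l * ∑ i : Fin n, (x.1 - -y.1) i.succ ^ 2 := by positivity
  linarith

/-- The reversed Cauchy-Schwarz inequality on the hyperboloid. -/
lemma one_le_form (hl : l < 0) (x y : Model n l) : 1 ≤ form l x.1 y.1 := by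
  have hx := x.2.1
  have hy := y.2.1
  have hx0 := x.2.2 hl.le
  have hy0 := y.2.2 hl.le
  have hcs := Finset.sum_mul_sq_le_sq_mul_sq Finset.univ (fun i : Fin n ↦ x.1 i.succ)
    (fun i ↦ y.1 i.succ)
  have hamgm : 2 * ∑ i : Fin n, x.1 i.succ * y.1 i.succ ≤
      ∑ i : Fin n, x.1 i.succ ^ 2 + ∑ i : Fin n, y.1 i.succ ^ 2 := by
    rw [Finset.mul_sum, ← Finset.sum_add_distrib]
    exact Finset.sum_le_sum fun i _ ↦ by nlinarith [sq_nonneg (x.1 i.succ - y.1 i.succ)]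
  rw [form]
  set X := ∑ i : Fin n, x.1 i.succ ^ 2
  set Y := ∑ i : Fin n, y.1 i.succ ^ 2
  set c := ∑ i : Fin n, x.1 i.succ * y.1 i.succ
  have h1 : (1 - l * c) ^ 2 ≤ (x.1 0 * y.1 0) ^ 2 := by
    have e : (x.1 0 * y.1 0) ^ 2 = (1 - l * X) * (1 - l * Y) := by
      rw [mul_pow, show x.1 0 ^ 2 = 1 - l * X by linarith, show y.1 0 ^ 2 = 1 - l * Y by linarith]
    rw [e]
    have h2 : l ^ 2 * c ^ 2 ≤ l ^ 2 * (X * Y) := mul_le_mul_of_nonneg_left hcs (sq_nonneg l)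
    have h3 : -l * (2 * c) ≤ -l * (X + Y) := mul_le_mul_of_nonneg_left hamgm (by linarith)
    nlinarith
  have := abs_le_of_sq_le_sq h1 (by positivity)
  linarith [le_abs_self (1 - l * c)]

lemma modelDist_eq_iff (hl : l ≠ 0) (x y x' y' : Model n l) :
    modelDist n l x y = modelDist n l x' y' ↔ form l x.1 y.1 = form l x'.1 y'.1 := by
  rcases hl.lt_or_gt with h | h
  · have hs : 1 / √(-l) ≠ 0 := by
      have := Real.sqrt_pos.2 (show 0 < -l by linarith)
      positivity
    simp only [modelDist, if_neg (not_lt.2 h.le), if_neg hl]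
    rw [mul_right_inj' hs]
    exact Real.arcosh_injOn.eq_iff (one_le_form h x y) (one_le_form h x' y')
  · have hs : 1 / √l ≠ 0 := by
      have := Real.sqrt_pos.2 h
      positivity
    simp only [modelDist, if_pos h]
    rw [mul_right_inj' hs]
    exact Real.arccos_injOn.eq_iff ⟨neg_one_le_form h x y, form_le_one h x y⟩
      ⟨neg_one_le_form h x' y', form_le_one h x' y'⟩

lemma modelDist_zero_eq_iff (x y x' y' : Model n 0) :
    modelDist n 0 x y = modelDist n 0 x' y' ↔
      ∑ i : Fin n, (x.1 i.succ - y.1 i.succ) ^ 2 =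
        ∑ i : Fin n, (x'.1 i.succ - y'.1 i.succ) ^ 2 := by
  simp only [modelDist, lt_irrefl, if_false, if_true]
  exact Real.sqrt_inj (Finset.sum_nonneg fun _ _ ↦ sq_nonneg _)
    (Finset.sum_nonneg fun _ _ ↦ sq_nonneg _)

lemma apply_zero_of_zero (x : Model n 0) : x.1 0 = 1 := by
  have h1 := x.2.1
  have h2 := x.2.2 le_rfl
  rw [zero_mul, add_zero] at h1
  nlinarith

/-- The size of the deviation of the points `modelPoint` from the base point. Any sufficiently
small positive number would do. -/
def spread (l : ℝ) : ℝ := (1 + |l|)⁻¹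

lemma spread_pos (l : ℝ) : 0 < spread l := by
  unfold spread; positivity

lemma one_sub_spread_pos (l : ℝ) : 0 < 1 - l * spread l ^ 2 := by
  have h1 : (1 + |l|) * spread l = 1 := mul_inv_cancel₀ (by positivity)
  have h2 := spread_pos l
  have h3 := le_abs_self l
  have h4 := abs_nonneg l
  nlinarith [mul_nonneg h4 h2.le, mul_nonneg (mul_nonneg h4 h2.le) h2.le,
    mul_le_mul_of_nonneg_right h3 (sq_nonneg (spread l))]

/-- The point `(1, 0)` of the model. -/
def basePoint (n : ℕ) (l : ℝ) : Model n l :=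
  ⟨WithLp.toLp 2 (Fin.cons 1 0), by simp⟩

/-- The points `(a, ± b eᵢ)` of the model, for suitable `a, b > 0`. -/
def modelPoint (n : ℕ) (l : ℝ) (i : Fin n) (ε : ℤˣ) : Model n l :=
  ⟨WithLp.toLp 2 (Fin.cons √(1 - l * spread l ^ 2) (Pi.single i (((ε : ℤ) : ℝ) * spread l))), by
    have h1 : ∑ j : Fin n, (Pi.single i (((ε : ℤ) : ℝ) * spread l) : Fin n → ℝ) j ^ 2 =
        spread l ^ 2 := by
      rw [Finset.sum_eq_single i]
      · rw [Pi.single_eq_same, mul_pow]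
        rcases Int.units_eq_one_or ε with rfl | rfl <;> simp
      · intro j _ hj
        rw [Pi.single_eq_of_ne hj]; ring
      · simp
    refine ⟨?_, fun _ ↦ ?_⟩
    · simp only [Fin.cons_zero, Fin.cons_succ, h1]
      rw [Real.sq_sqrt (one_sub_spread_pos l).le]; ring
    · exact Real.sqrt_pos.2 (one_sub_spread_pos l)⟩

/-- The linear extension of a self-map of the model, as far as it exists: the linear map which has
the prescribed value at `(1, 0)` and on the vectors `(a, b eᵢ) - (a, - b eᵢ)`. -/
def extend (f : Model n l → Model n l) : V n →L[ℝ] V n :=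
  (EuclideanSpace.proj 0 : V n →L[ℝ] ℝ).smulRight (f (basePoint n l)).1 +
    ∑ i : Fin n, (EuclideanSpace.proj i.succ : V n →L[ℝ] ℝ).smulRight
      ((2 * spread l)⁻¹ • ((f (modelPoint n l i 1)).1 - (f (modelPoint n l i (-1))).1))

lemma extend_apply (f : Model n l → Model n l) (x : V n) :
    extend f x = x 0 • (f (basePoint n l)).1 + ∑ i : Fin n, x i.succ •
      ((2 * spread l)⁻¹ • ((f (modelPoint n l i 1)).1 - (f (modelPoint n l i (-1))).1)) := by
  simp [extend]

/-- The model spans the ambient vector space. -/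
lemma extend_id (x : V n) : extend (id : Model n l → Model n l) x = x := by
  have hs := (spread_pos l).ne'
  rw [extend_apply]
  ext j
  induction j using Fin.cases with
  | zero => simp [basePoint, modelPoint]
  | succ j =>
    simp only [id_eq, basePoint, modelPoint, PiLp.add_apply, PiLp.smul_apply, smul_eq_mul,
      Fin.cons_succ, Pi.zero_apply, mul_zero, zero_add, WithLp.ofLp_sum, Finset.sum_apply,
      PiLp.sub_apply]
    rw [Finset.sum_eq_single j]
    · simp
      field_simp
      ring
    · intro i _ hij
      rw [Pi.single_eq_of_ne hij.symm, Pi.single_eq_of_ne hij.symm]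
      simp
    · simp

/-- Linear relations which are satisfied by the values of a map on the model are inherited by
`extend`. -/
lemma map_extend_eq {f : Model n l → Model n l} {W : Type*} [AddCommGroup W] [Module ℝ W]
    {Φ Ψ : V n →ₗ[ℝ] W} (h : ∀ x : Model n l, Φ (f x).1 = Ψ x.1) (x : V n) :
    Φ (extend f x) = Ψ x := by
  conv_rhs => rw [← extend_id (l := l) x]
  simp only [extend_apply, map_add, map_sum, map_smul, map_sub, h, id_eq]

lemma linearMap_ext_model {W : Type*} [AddCommGroup W] [Module ℝ W]
    {Φ Ψ : V n →ₗ[ℝ] W} (h : ∀ x : Model n l, Φ x.1 = Ψ x.1) : Φ = Ψ :=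
  LinearMap.ext fun x ↦ by
    have := map_extend_eq (f := (id : Model n l → Model n l)) h x
    rwa [extend_id] at this

lemma form_iso (hl : l ≠ 0) (f : Iso n l) (x y : Model n l) :
    form l (f.1 x).1 (f.1 y).1 = form l x.1 y.1 :=
  (modelDist_eq_iff hl _ _ _ _).1 (f.2 x y)

lemma form_extend_iso (hl : l ≠ 0) (f : Iso n l) (x : V n) (y : Model n l) :
    form l (extend f.1 x) (f.1 y).1 = form l x y.1 :=
  map_extend_eq (Φ := formLeft l (f.1 y).1) (Ψ := formLeft l y.1) (fun z ↦ form_iso hl f z y) x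

lemma eq_zero_of_form_eq_zero (hl : l ≠ 0) {z : V n} (h : ∀ y : Model n l, form l z y.1 = 0) :
    z = 0 := by
  have h1 : formLeft l z = 0 := linearMap_ext_model (l := l) fun y ↦ by
    rw [formLeft_apply, form_comm, h]; rfl
  have h2 : ∀ y, form l y z = 0 := fun y ↦ by rw [← formLeft_apply, h1]; rfl
  ext j
  have := h2 (EuclideanSpace.single j 1)
  rw [form_eq_sum, Finset.sum_eq_single j] at this
  · have hd : formDiag (n := n) l j ≠ 0 := by
      induction j using Fin.cases <;> simp [hl]
    simpa [hd] using this
  · intro i _ hi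
    simp [hi]
  · simp

/-- The scalar product of the components in `ℝ^n`, as a linear functional. -/
def spatial (y : V n) : V n →ₗ[ℝ] ℝ where
  toFun x := ∑ i : Fin n, x i.succ * y i.succ
  map_add' x x' := by
    simp only [PiLp.add_apply, add_mul, Finset.sum_add_distrib]
  map_smul' c x := by
    simp only [PiLp.smul_apply, smul_eq_mul, RingHom.id_apply, mul_assoc, ← Finset.mul_sum]

lemma spatial_apply (x y : V n) : spatial y x = ∑ i : Fin n, x i.succ * y i.succ := rfl

lemma spatial_comm (x y : V n) : spatial y x = spatial x y := by
  simp only [spatial_apply, mul_comm]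

lemma spatial_sub_sub (x y : V n) :
    spatial (x - y) (x - y) = spatial x x - 2 * spatial y x + spatial y y := by
  rw [map_sub, spatial_comm x, spatial_comm y, map_sub, map_sub, spatial_comm y x]
  ring

lemma spatial_basePoint (x : V n) : spatial x (basePoint n l).1 = 0 := by
  simp [spatial_apply, basePoint]

/-- For `l = 0`, an isometry preserves scalar products up to a translation. -/
lemma spatial_iso (f : Iso n 0) (x y : Model n 0) :
    spatial ((f.1 y).1 - (f.1 (basePoint n 0)).1) ((f.1 x).1 - (f.1 (basePoint n 0)).1) =
      spatial y.1 x.1 := by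
  have h : ∀ x y : Model n 0, spatial ((f.1 x).1 - (f.1 y).1) ((f.1 x).1 - (f.1 y).1) =
      spatial (x.1 - y.1) (x.1 - y.1) := fun x y ↦ by
    have := (modelDist_zero_eq_iff _ _ _ _).1 (f.2 x y)
    simpa only [spatial_apply, PiLp.sub_apply, sq] using this
  have h1 := h x y
  have h2 := h x (basePoint n 0)
  have h3 := h y (basePoint n 0)
  rw [← sub_sub_sub_cancel_right (f.1 x).1 (f.1 y).1 (f.1 (basePoint n 0)).1, spatial_sub_sub,
    spatial_sub_sub x.1 y.1, h2, h3, spatial_sub_sub, spatial_sub_sub,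
    spatial_comm x.1 (basePoint n 0).1, spatial_comm y.1 (basePoint n 0).1,
    spatial_basePoint, spatial_basePoint, spatial_basePoint] at h1
  linarith

/-- The functional `v ↦ ⟨v - v₀ p, q⟩`. -/
def spatialShift (p q : V n) : V n →ₗ[ℝ] ℝ :=
  spatial q - (spatial q p) • (EuclideanSpace.proj 0 : V n →L[ℝ] ℝ).toLinearMap

lemma spatialShift_apply (p q v : V n) : spatialShift p q v = spatial q (v - v 0 • p) := by
  rw [map_sub, map_smul]
  simp [spatialShift, mul_comm]

/-- For `l = 0`, all points of the model have first coordinate `1`, so that `extend` preserves the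
first coordinate. -/
lemma extend_apply_zero (f : Model n 0 → Model n 0) (x : V n) : extend f x 0 = x 0 :=
  map_extend_eq (f := f) (Φ := (EuclideanSpace.proj 0 : V n →L[ℝ] ℝ).toLinearMap)
    (Ψ := (EuclideanSpace.proj 0 : V n →L[ℝ] ℝ).toLinearMap)
    (fun x ↦ (apply_zero_of_zero (f x)).trans (apply_zero_of_zero x).symm) x

lemma spatial_extend_iso (f : Iso n 0) (x : V n) (y : Model n 0) :
    spatial ((f.1 y).1 - (f.1 (basePoint n 0)).1)
      (extend f.1 x - x 0 • (f.1 (basePoint n 0)).1) = spatial y.1 x := by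
  have := map_extend_eq (f := f.1)
    (Φ := spatialShift (f.1 (basePoint n 0)).1 ((f.1 y).1 - (f.1 (basePoint n 0)).1))
    (Ψ := spatial y.1) (fun z ↦ by
      rw [spatialShift_apply, apply_zero_of_zero, one_smul, spatial_iso]) x
  rwa [spatialShift_apply, extend_apply_zero] at this

/-- Isometries of the model are restrictions of linear maps. -/
lemma extend_iso_apply (f : Iso n l) (x : Model n l) : extend f.1 x.1 = (f.1 x).1 := by
  rw [← sub_eq_zero]
  rcases eq_or_ne l 0 with rfl | hl
  · set z := extend f.1 x.1 - (f.1 x).1 with hz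
    set p := (f.1 (basePoint n 0)).1 with hp
    have hz0 : z 0 = 0 := by
      rw [hz, PiLp.sub_apply, extend_apply_zero, apply_zero_of_zero, apply_zero_of_zero, sub_self]
    have h1 : ∀ y : Model n 0, spatial (y.1 - p) z = 0 := fun y ↦ by
      obtain ⟨y, rfl⟩ := f.1.surjective y
      have h2 := spatial_extend_iso f x.1 y
      rw [← spatial_iso f x y, apply_zero_of_zero, one_smul, ← sub_eq_zero, ← map_sub,
        sub_sub_sub_cancel_right] at h2
      exact h2
    have h2 : spatial z p = 0 := by
      have := h1 (basePoint n 0)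
      rw [spatial_comm, map_sub, spatial_basePoint] at this
      linarith
    have h3 : spatial z = 0 := linearMap_ext_model (l := 0) fun y ↦ by
      have := h1 y
      rw [spatial_comm, map_sub, h2, sub_zero] at this
      exact this
    ext j
    induction j using Fin.cases with
    | zero => exact hz0
    | succ j =>
      have := LinearMap.congr_fun h3 (EuclideanSpace.single j.succ 1)
      simpa [spatial_apply, PiLp.single_apply] using this
  · refine eq_zero_of_form_eq_zero hl fun y ↦ ?_
    obtain ⟨y, rfl⟩ := f.1.surjective y
    rw [← formLeft_apply, map_sub, formLeft_apply, formLeft_apply, form_extend_iso hl,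
      form_iso hl, sub_self]

/-! ### The action of the groups on the models -/

lemma form_mem_G (hl : l ≠ 0) {g : GLV n} (hg : g ∈ G n l) (x y : V n) :
    form l ((g : V n →L[ℝ] V n) x) ((g : V n →L[ℝ] V n) y) = form l x y :=
  (preservesForm_mat_iff _).1 ((mem_SOeta_iff hl g).1 (G_le_SOeta hl hg)).1 x y

/-- The groups `G_l` preserve the models. For `l < 0`, a connected group cannot move a point of one
sheet of the hyperboloid to the other one. -/
lemma apply_mem_model (hn : 2 ≤ n) {g : GLV n} (hg : g ∈ G n l) (x : Model n l) :
    ((g : V n →L[ℝ] V n) x.1) 0 ^ 2 + l * ∑ i : Fin n, ((g : V n →L[ℝ] V n) x.1) i.succ ^ 2 = 1 ∧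
      (l ≤ 0 → 0 < ((g : V n →L[ℝ] V n) x.1) 0) := by
  rcases eq_or_ne l 0 with rfl | hl
  · rw [G_zero] at hg
    obtain ⟨w, B, -, h⟩ := hg
    rw [(h x.1).1, apply_zero_of_zero]
    simp
  · have h1 : ∀ g ∈ G n l, ((g : V n →L[ℝ] V n) x.1) 0 ^ 2 +
        l * ∑ i : Fin n, ((g : V n →L[ℝ] V n) x.1) i.succ ^ 2 = 1 := fun g hg ↦ by
      rw [← form_self, form_mem_G hl hg, form_self_model]
    refine ⟨h1 g hg, fun hl0 ↦ ?_⟩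
    by_contra hneg
    have hc : ContinuousOn (fun g : GLV n ↦ ((g : V n →L[ℝ] V n) x.1) 0) (G n l) := by
      have : Continuous fun g : GLV n ↦ (g : V n →L[ℝ] V n) := Units.continuous_val
      exact Continuous.continuousOn (by fun_prop)
    obtain ⟨h, hh, hh0⟩ := (isPreconnected_G hn l).intermediate_value hg (one_mem _) hc
      (show (0 : ℝ) ∈ _ from ⟨not_lt.1 hneg, (x.2.2 hl0).le⟩)
    have h2 := h1 h hh
    simp only at hh0
    rw [hh0] at h2
    have h3 : 0 ≤ ∑ i : Fin n, ((h : V n →L[ℝ] V n) x.1) i.succ ^ 2 :=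
      Finset.sum_nonneg fun _ _ ↦ sq_nonneg _
    nlinarith

lemma modelDist_apply (hn : 2 ≤ n) {g : GLV n} (hg : g ∈ G n l) (x y : Model n l) :
    modelDist n l ⟨(g : V n →L[ℝ] V n) x.1, apply_mem_model hn hg x⟩
      ⟨(g : V n →L[ℝ] V n) y.1, apply_mem_model hn hg y⟩ = modelDist n l x y := by
  rcases eq_or_ne l 0 with rfl | hl
  · rw [modelDist_zero_eq_iff]
    rw [G_zero] at hg
    obtain ⟨w, B, hB, h⟩ := hg
    have hBB := (Matrix.mem_orthogonalGroup_iff' _ _).1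
      (Matrix.mem_specialOrthogonalGroup_iff.1 hB).1
    set u : Fin n → ℝ := fun j ↦ x.1 j.succ - y.1 j.succ with hu
    have e : ∀ i : Fin n, (g : V n →L[ℝ] V n) x.1 i.succ - (g : V n →L[ℝ] V n) y.1 i.succ =
        B.mulVec u i := fun i ↦ by
      rw [(h _).2, (h _).2, apply_zero_of_zero, apply_zero_of_zero, add_sub_add_left_eq_sub,
        ← Finset.sum_sub_distrib, Matrix.mulVec, dotProduct]
      simp only [hu, mul_sub]
    simp only [e]
    have h1 : B.mulVec u ⬝ᵥ B.mulVec u = u ⬝ᵥ u := by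
      rw [Matrix.dotProduct_mulVec, ← Matrix.mulVec_transpose, Matrix.mulVec_mulVec]
      change (B.transpose * B).mulVec u ⬝ᵥ u = _
      rw [show B.transpose * B = 1 from hBB, Matrix.one_mulVec]
    simpa only [dotProduct, sq] using h1
  · rw [modelDist_eq_iff hl]
    exact form_mem_G hl hg x.1 y.1

/-- The action of an element of `G_l` on the model, as a permutation. -/
def actPerm (hn : 2 ≤ n) (g : G n l) : Equiv.Perm (Model n l) where
  toFun x := ⟨(g.1 : V n →L[ℝ] V n) x.1, apply_mem_model hn g.2 x⟩
  invFun x := ⟨((g⁻¹).1 : V n →L[ℝ] V n) x.1, apply_mem_model hn (g⁻¹).2 x⟩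
  left_inv x := Subtype.ext (congrArg (fun T : V n →L[ℝ] V n ↦ T x.1) g.1.inv_mul)
  right_inv x := Subtype.ext (congrArg (fun T : V n →L[ℝ] V n ↦ T x.1) g.1.mul_inv)

/-- The homomorphism from `G_l` to the isometry group of the model. -/
def act (hn : 2 ≤ n) (l : ℝ) : G n l →* Iso n l where
  toFun g := ⟨actPerm hn g, fun x y ↦ modelDist_apply hn g.2 x y⟩
  map_one' := rfl
  map_mul' _ _ := rfl

lemma act_apply (hn : 2 ≤ n) (g : G n l) (x : Model n l) :
    (((act hn l g).1 x : Model n l) : V n) = (g.1 : V n →L[ℝ] V n) x.1 := rfl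

lemma continuous_iso_apply (x : Model n l) : Continuous fun f : Iso n l ↦ f.1 x :=
  (continuous_apply x).comp continuous_induced_dom

lemma continuous_act (hn : 2 ≤ n) : Continuous (act (n := n) hn l) := by
  refine continuous_induced_rng.2 (continuous_pi fun x ↦ ?_)
  refine Topology.IsInducing.subtypeVal.continuous_iff.2 ?_
  change Continuous fun g : G n l ↦ (g.1 : V n →L[ℝ] V n) x.1
  have : Continuous fun g : G n l ↦ (g.1 : V n →L[ℝ] V n) :=
    Units.continuous_val.comp continuous_subtype_val
  fun_prop

/-! ### The linear extension of isometries -/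

lemma extend_one : extend ((1 : Iso n l).1 : Model n l → Model n l) = 1 :=
  ContinuousLinearMap.ext extend_id

lemma extend_mul (f g : Iso n l) : extend (f * g).1 = extend f.1 * extend g.1 := by
  have : (extend (f * g).1).toLinearMap = (extend f.1 * extend g.1).toLinearMap :=
    linearMap_ext_model (l := l) fun x ↦ by
      change extend (f * g).1 x.1 = extend f.1 (extend g.1 x.1)
      rw [extend_iso_apply, extend_iso_apply, extend_iso_apply]
      rfl
  exact ContinuousLinearMap.coe_injective this

/-- The linear extension of isometries of the model, as a homomorphism. -/
def linearization (n : ℕ) (l : ℝ) : Iso n l →* GLV n :=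
  MonoidHom.toHomUnits
    { toFun := fun f ↦ extend f.1
      map_one' := extend_one
      map_mul' := extend_mul }

lemma val_linearization (f : Iso n l) : (linearization n l f : V n →L[ℝ] V n) = extend f.1 := rfl

lemma continuous_linearization : Continuous (linearization n l) := by
  refine Units.isOpenEmbedding_val.isInducing.continuous_iff.2 ?_
  change Continuous fun f : Iso n l ↦ extend f.1
  have h : ∀ x : Model n l, Continuous fun f : Iso n l ↦ (f.1 x).1 := fun x ↦
    continuous_subtype_val.comp (continuous_iso_apply x)
  have h2 : ∀ c : V n →L[ℝ] ℝ, Continuous fun v : V n ↦ c.smulRight v := fun c ↦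
    (ContinuousLinearMap.smulRightL ℝ (V n) (V n) c).continuous
  refine ((h2 _).comp (h _)).add (continuous_finsetSum _ fun i _ ↦ (h2 _).comp ?_)
  exact Continuous.const_smul ((h _).sub (h _)) ((2 * spread l)⁻¹)

lemma linearization_act (hn : 2 ≤ n) (g : G n l) : linearization n l (act hn l g) = g := by
  ext1
  have : (extend (act hn l g).1).toLinearMap = (g.1 : V n →L[ℝ] V n).toLinearMap :=
    linearMap_ext_model (l := l) fun x ↦ by
      change extend (act hn l g).1 x.1 = (g.1 : V n →L[ℝ] V n) x.1
      rw [extend_iso_apply, act_apply]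
  exact ContinuousLinearMap.coe_injective this

lemma isEmbedding_act (hn : 2 ≤ n) : Topology.IsEmbedding (act (n := n) hn l) := by
  refine .of_comp (continuous_act hn) continuous_linearization ?_
  have : linearization n l ∘ act hn l = Subtype.val := funext fun g ↦ linearization_act hn g
  rw [this]
  exact Topology.IsEmbedding.subtypeVal

lemma preservesForm_linearization (hl : l ≠ 0) (f : Iso n l) :
    PreservesForm l (mat (linearization n l f : V n →L[ℝ] V n)) := by
  rw [preservesForm_mat_iff, val_linearization]
  intro x y
  rw [form_comm, form_comm x]
  exact map_extend_eq (f := f.1) (Φ := formLeft l (extend f.1 x)) (Ψ := formLeft l x) (fun z ↦ by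
    rw [formLeft_apply, formLeft_apply, form_comm, form_extend_iso hl, form_comm]) y

lemma submatrix_linearization_mem (f : Iso n 0) :
    (mat (linearization n 0 f : V n →L[ℝ] V n)).submatrix Fin.succ Fin.succ ∈
      Matrix.orthogonalGroup (Fin n) ℝ := by
  rw [Matrix.mem_orthogonalGroup_iff', val_linearization]
  set p := (f.1 (basePoint n 0)).1 with hp
  have key : ∀ x y : V n, spatial (extend f.1 y - y 0 • p) (extend f.1 x - x 0 • p) =
      spatial y x := fun x y ↦ by
    have := map_extend_eq (f := f.1) (Φ := spatialShift p (extend f.1 x - x 0 • p))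
      (Ψ := spatial x) (fun z ↦ by
        rw [spatialShift_apply, apply_zero_of_zero, one_smul, spatial_comm, spatial_extend_iso,
          spatial_comm]) y
    rw [spatialShift_apply, extend_apply_zero] at this
    rw [spatial_comm, this, spatial_comm]
  ext i j
  have h := key (EuclideanSpace.single i.succ 1) (EuclideanSpace.single j.succ 1)
  have e : ∀ i : Fin n, (EuclideanSpace.single i.succ (1 : ℝ) : V n) 0 = 0 := fun i ↦ by
    simp
  rw [e, e, zero_smul, sub_zero, sub_zero, spatial_apply, spatial_apply] at h
  simp only [← mat_apply] at h
  simpa [Matrix.mul_apply, Matrix.one_apply, PiLp.single_apply, Matrix.star_apply, eq_comm] using h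

lemma mat_linearization_zero (f : Iso n 0) (j : Fin (n + 1)) :
    mat (linearization n 0 f : V n →L[ℝ] V n) 0 j = if j = 0 then 1 else 0 := by
  rw [mat_apply, val_linearization, extend_apply_zero]
  simp [PiLp.single_apply, eq_comm]

lemma det_submatrix_linearization (f : Iso n 0) :
    (mat (linearization n 0 f : V n →L[ℝ] V n)).det =
      ((mat (linearization n 0 f : V n →L[ℝ] V n)).submatrix Fin.succ Fin.succ).det :=
  det_eq_det_submatrix (by simp [mat_linearization_zero]) fun j ↦ by
    rw [mat_linearization_zero, if_neg (Fin.succ_ne_zero j)]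

lemma det_linearization (f : Iso n l) :
    (mat (linearization n l f : V n →L[ℝ] V n)).det = 1 ∨
      (mat (linearization n l f : V n →L[ℝ] V n)).det = -1 := by
  rcases eq_or_ne l 0 with rfl | hl
  · rw [det_submatrix_linearization, ← mul_self_eq_one_iff]
    have := Matrix.det_of_mem_unitary (submatrix_linearization_mem f)
    simpa using (Unitary.mem_iff.1 this).1
  · exact (preservesForm_linearization hl f).det_sq hl

lemma linearization_mem_SOeta (hl : l ≠ 0) {f : Iso n l}
    (hf : (mat (linearization n l f : V n →L[ℝ] V n)).det = 1) :
    linearization n l f ∈ SOeta n l :=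
  (mem_SOeta_iff hl _).2 ⟨preservesForm_linearization hl f, hf⟩

lemma linearization_mem_euclideanGroup {f : Iso n 0}
    (hf : (mat (linearization n 0 f : V n →L[ℝ] V n)).det = 1) :
    linearization n 0 f ∈ euclideanGroup n := by
  refine ⟨fun i ↦ mat (linearization n 0 f : V n →L[ℝ] V n) i.succ 0,
    (mat (linearization n 0 f : V n →L[ℝ] V n)).submatrix Fin.succ Fin.succ, ?_,
    fun x ↦ ⟨?_, fun i ↦ ?_⟩⟩
  · rw [Matrix.mem_specialOrthogonalGroup_iff, ← det_submatrix_linearization]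
    exact ⟨submatrix_linearization_mem f, hf⟩
  · rw [val_linearization, extend_apply_zero]
  · rw [apply_eq_sum, Fin.sum_univ_succ]
    simp [mul_comm]

/-- The linear extension maps the identity component of the isometry group to `G_l`, as the
determinant, which only takes the values `1` and `-1`, is constant on this component. -/
lemma linearization_mem_G {f : Iso n l} (hf : f ∈ connectedComponent (1 : Iso n l)) :
    linearization n l f ∈ G n l := by
  have hdet : ∀ f ∈ connectedComponent (1 : Iso n l),
      (mat (linearization n l f : V n →L[ℝ] V n)).det = 1 := fun f hf ↦ by
    refine isPreconnected_connectedComponent.eq_one_of_eq_one_or_neg_one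
      (f := fun f : Iso n l ↦ (mat (linearization n l f : V n →L[ℝ] V n)).det) ?_
      (fun f _ ↦ det_linearization f) mem_connectedComponent ?_ hf
    · exact ((continuous_mat.comp (Units.continuous_val.comp
        continuous_linearization)).matrix_det).continuousOn
    · simp only [map_one, Units.val_one, Matrix.det_one]
  rcases lt_trichotomy l 0 with hl | rfl | hl
  · refine subset_G_of_isPreconnected hl (isPreconnected_connectedComponent.image _
      continuous_linearization.continuousOn) ⟨1, mem_connectedComponent, map_one _⟩ ?_ ⟨f, hf, rfl⟩
    rintro _ ⟨f, hf, rfl⟩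
    exact linearization_mem_SOeta hl.ne (hdet f hf)
  · rw [G_zero]
    exact linearization_mem_euclideanGroup (hdet f hf)
  · rw [G_of_pos hl]
    exact linearization_mem_SOeta hl.ne' (hdet f hf)

lemma range_act (hn : 2 ≤ n) :
    Set.range (act (n := n) hn l) = connectedComponent (1 : Iso n l) := by
  apply Set.Subset.antisymm
  · have : PreconnectedSpace (G n l) :=
      isPreconnected_iff_preconnectedSpace.1 (isPreconnected_G hn l)
    exact (isPreconnected_range (continuous_act hn)).subset_connectedComponent ⟨1, map_one _⟩
  · intro f hf
    refine ⟨⟨linearization n l f, linearization_mem_G hf⟩, ?_⟩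
    refine Subtype.ext (Equiv.ext fun x ↦ Subtype.ext ?_)
    rw [act_apply]
    exact extend_iso_apply f x

end SpaceForms

end

theorem mainTheorem7 (n : ℕ) (hn : 2 ≤ n) :
    -- `G_l` acts on the space form of curvature `l`, and this identifies it, as a topological
    -- group, with the identity component of the isometry group
    (∀ l : ℝ, ∃ φ : SpaceForms.G n l →* SpaceForms.Iso n l,
      (∀ (g : SpaceForms.G n l) (x : SpaceForms.Model n l),
        (((φ g : Equiv.Perm (SpaceForms.Model n l)) x : SpaceForms.Model n l) : SpaceForms.V n) =
          ((g : SpaceForms.GLV n) : SpaceForms.V n →L[ℝ] SpaceForms.V n) x) ∧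
      Topology.IsEmbedding φ ∧
      Set.range φ = connectedComponent (1 : SpaceForms.Iso n l)) ∧
    -- the union of the `{l} × G_l` is an embedded submanifold of `ℝ × GL(n+1)`, and is a bundle of
    -- Lie groups over `ℝ` which is not locally trivial at `0`
    ∃ (_ : ChartedSpace (EuclideanSpace ℝ (Fin (1 + n * (n + 1) / 2))) (SpaceForms.Total n))
      (_ : IsManifold (𝓡 (1 + n * (n + 1) / 2)) ∞ (SpaceForms.Total n))
      (B : LieGroupoid 𝓘(ℝ, ℝ) (𝓡 (1 + n * (n + 1) / 2)) ℝ (SpaceForms.Total n)),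
      IsSmoothEmbedding (𝓡 (1 + n * (n + 1) / 2))
        (𝓘(ℝ, ℝ).prod 𝓘(ℝ, SpaceForms.V n →L[ℝ] SpaceForms.V n)) ∞
        (Subtype.val : SpaceForms.Total n → ℝ × SpaceForms.GLV n) ∧
      B.IsLieGroupBundle ∧
      (∀ g, B.source g = g.1.1) ∧
      (∀ g h e, (B.comp g h e).1.2 = g.1.2 * h.1.2) ∧
      ¬ B.IsTopologicallyLocallyTrivialAt 0 := by
  refine ⟨fun l ↦ ⟨SpaceForms.act hn l, fun _ _ ↦ rfl, SpaceForms.isEmbedding_act hn,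
      SpaceForms.range_act hn⟩,
    SpaceForms.totalChartedSpace hn, (SpaceForms.totalAtlas hn).isManifold,
    SpaceForms.lieGroupBundle hn, (SpaceForms.totalAtlas hn).isSmoothEmbedding_val, rfl,
    fun _ ↦ rfl, fun _ _ _ ↦ rfl, ?_⟩
  rintro ⟨U, hU, h0, Φ, hΦ⟩
  exact SpaceForms.not_exists_homeomorph hn hU h0 Φ hΦ
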